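/- There is an absolute constant $C>0$ such that the following holds. Let $r$ be a natural number, let $G=(V,E,w)$ be a finite undirected graph with nonnegative real edge weights that is $K_r$-minor-free, and let $K\subseteq V$ be an arbitrary set of terminals. Write $\delta_G$ for the shortest-path distance in $G$ (with value $\infty$ between vertices in different components). Then there is a minor $M$ of $G$ with vertex set $K$, i.e. there are pairwise disjoint vertex sets $B_t\subseteq V$ $(t\in K)$ with $t\in B_t$, each inducing a connected subgraph of $G$, such that for every edge $tt'$ of $M$ some edge of $G$ joins $B_t$ to $B_{t'}$; and if every edge $tt'$ of $M$ is given the weight $\delta_G(t,t')$, then the shortest-path distance $\delta_M$ of $M$ satisfies $$\delta_G(t,t')\;\le\;\delta_M(t,t')\;\le\;2^{C\,r\log r}\cdot\delta_G(t,t')\qquad\text{for all } t,t'\in K.$$ In other words, the Steiner point removal problem on $K_r$-minor-free graphs has a solution with distortion $2^{O(r\log r)}$. -/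

import Mathlib

open scoped NNReal ENNReal

namespace SPR

/-- A model of the graph `H` as a minor of the graph `G`: pairwise disjoint vertex sets of `G`
(the branch sets, one for every vertex of `H`), each inducing a connected (hence nonempty)
subgraph of `G`, such that every edge of `H` is realised by an edge of `G` between the two
branch sets. Contracting the branch sets and deleting what is not needed turns `G` into `H`. -/
structure MinorModel {U V : Type*} (H : SimpleGraph U) (G : SimpleGraph V) where
  /-- The set of vertices of `G` that is contracted to the vertex `u` of `H`. -/
  branch : U → Set V
  connected : ∀ u, (G.induce (branch u)).Connected
  disjoint : ∀ u v, u ≠ v → Disjoint (branch u) (branch v)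
  adj : ∀ u v, H.Adj u v → ∃ x ∈ branch u, ∃ y ∈ branch v, G.Adj x y

/-- `H` is a minor of `G`. -/
def IsMinor {U V : Type*} (H : SimpleGraph U) (G : SimpleGraph V) : Prop :=
  Nonempty (MinorModel H G)

/-- `G` is `K_r`-minor-free: the complete graph on `r` vertices is not a minor of `G`. -/
def CliqueMinorFree {V : Type*} (r : ℕ) (G : SimpleGraph V) : Prop :=
  ¬ IsMinor (⊤ : SimpleGraph (Fin r)) G

/-- The length of a walk for the edge weights `w` (with multiplicity). Only the values of `w` at
edges of `G` matter. -/
noncomputable def walkLength {V : Type*} {G : SimpleGraph V} (w : Sym2 V → ℝ≥0) {u v : V}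
    (p : G.Walk u v) : ℝ≥0 :=
  (p.edges.map w).sum

/-- The shortest-path distance in the edge-weighted graph `(G, w)`; it is `∞` when no walk
connects the two vertices. -/
noncomputable def wdist {V : Type*} (G : SimpleGraph V) (w : Sym2 V → ℝ≥0) (u v : V) : ℝ≥0∞ :=
  ⨅ p : G.Walk u v, (walkLength w p : ℝ≥0∞)

/-- The edge-weighted graph `(M, wM)`, whose vertex set is the terminal set `K`, is a solution
with distortion `α` to the Steiner point removal problem on `(G, w)` and `K`. -/
structure IsSolution {V : Type*} (G : SimpleGraph V) (w : Sym2 V → ℝ≥0) (K : Set V) (α : ℝ)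
    (M : SimpleGraph K) (wM : Sym2 K → ℝ≥0) : Prop where
  /-- `M` is a minor of `G` on the vertex set `K`: the supernode named by the terminal `t` is
  obtained by contracting a connected vertex set that contains `t`. -/
  minor : ∃ B : MinorModel M G, ∀ t : K, (t : V) ∈ B.branch t
  /-- Every edge of `M` is weighted by the distance in `G` of its endpoints. -/
  weight : ∀ s t : K, M.Adj s t → (wM s(s, t) : ℝ≥0∞) = wdist G w s t
  /-- Distances between terminals do not decrease. -/
  lower : ∀ s t : K, wdist G w s t ≤ wdist M wM s t
  /-- Distances between terminals increase at most by the factor `α`. -/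
  upper : ∀ s t : K, wdist M wM s t ≤ ENNReal.ofReal α * wdist G w s t

end SPR

/-! The proof builds a buffered cop decomposition, cuts it into clusters, and contracts Voronoi
cells of the cluster graph.

Supernodes are created one by one, each as a shortest-path tree with at most `r` branches inside a
component of the unassigned part, reaching every older supernode adjacent to that component. Hence
the supernodes around a component are pairwise adjacent; together with the component they form a
clique minor, so there are fewer than `r` of them. When an older supernode comes within distance one
of a component that it does not touch, the younger adjacent supernodes grow until the buffer is
restored (`Valid.exists_grow`); otherwise a new supernode is created (`Valid.exists_create`). A
growth costs a supernode at most `r + 1` in radius and removes one older supernode from the near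
ones, so its total growth is at most `(r + 1) * r`.

Cutting the trees into bands gives clusters of radius `O(r²)`. A walk of length below one meets at
most `2 * r` clusters of its oldest supernode. The pieces in between have one more near older
supernode, of which there are fewer than `r`. Recursion replaces the walk by `h = (6 * r + 6) ^ r`
edges, moves inside clusters being free (`IsDecomposition.shortcut`).

Dividing the weights by the distance `D` to the terminals turns this into clusters of radius at most
`D` in which walks of length `ε * D` can be shortcut, `ε` being of order `1 / r²`
(`exists_isClustering`). The Voronoi cells of the terminals in the cluster graph then reach their
terminals within `O(h / ε) * D` (`IsClustering.exists_voronoi`). The minor contracts these cells. A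
walk of `G` is cut greedily into pieces of length about `ε * D`; each costs `h` edges of length `O(h
/ ε) * D`, so the distortion is `O(h² / ε²)`, which is `r ^ O(r)` (`IsClustering.exists_minor`).
Zero weights are handled by perturbation and a limit. -/

namespace SPR

/-! ### Walks inside a vertex set. -/

/-- There is a walk of length `L` from one vertex to another all of whose vertices lie in `S`. -/
inductive WalkIn {V : Type*} (G : SimpleGraph V) (ω : V → V → ℝ) (S : Set V) :
    ℝ → V → V → Prop
  | nil {u : V} : u ∈ S → WalkIn G ω S 0 u u
  | cons {u v z : V} {L : ℝ} : u ∈ S → G.Adj u v → WalkIn G ω S L v z →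
      WalkIn G ω S (ω u v + L) u z

namespace WalkIn

variable {V : Type*} {G : SimpleGraph V} {ω : V → V → ℝ} {S T : Set V} {L L' : ℝ} {u v z : V}

theorem mono (h : WalkIn G ω S L u v) (hST : S ⊆ T) : WalkIn G ω T L u v := by
  induction h with
  | nil hu => exact nil (hST hu)
  | cons hu ha _ ih => exact cons (hST hu) ha ih

theorem left_mem (h : WalkIn G ω S L u v) : u ∈ S := by
  cases h <;> assumption

theorem right_mem (h : WalkIn G ω S L u v) : v ∈ S := by
  induction h <;> assumption

theorem trans (h : WalkIn G ω S L u v) (h' : WalkIn G ω S L' v z) :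
    WalkIn G ω S (L + L') u z := by
  induction h with
  | nil _ => simpa using h'
  | cons hu ha _ ih => rw [add_assoc]; exact cons hu ha (ih h')

theorem single (hu : u ∈ S) (hv : v ∈ S) (h : G.Adj u v) : WalkIn G ω S (ω u v) u v := by
  simpa using cons (ω := ω) hu h (nil hv)

theorem symm (hs : ∀ u v, ω u v = ω v u) (h : WalkIn G ω S L u v) : WalkIn G ω S L v u := by
  induction h with
  | nil hu => exact nil hu
  | cons hu ha hw ih =>
    rw [add_comm, hs]
    exact ih.trans (single hw.left_mem hu ha.symm)

theorem nonneg (hp : ∀ u v, G.Adj u v → 0 < ω u v) (h : WalkIn G ω S L u v) : 0 ≤ L := by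
  induction h with
  | nil _ => exact le_rfl
  | cons _ ha _ ih => exact add_nonneg (hp _ _ ha).le ih

theorem first_exit (h : WalkIn G ω S L u v) {H : Set V} (hu : u ∈ H) (hv : v ∉ H) :
    ∃ x y L₁ L₂, x ∈ H ∧ y ∉ H ∧ G.Adj x y ∧ WalkIn G ω (S ∩ H) L₁ u x ∧
      WalkIn G ω S L₂ y v ∧ L = L₁ + ω x y + L₂ := by
  induction h with
  | nil _ => exact absurd hu hv
  | @cons u v z L hS ha hw ih =>
    by_cases hvH : v ∈ H
    · obtain ⟨x, y, L₁, L₂, hx, hy, hxy, h₁, h₂, rfl⟩ := ih hvH hv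
      exact ⟨x, y, _, L₂, hx, hy, hxy, cons ⟨hS, hu⟩ ha h₁, h₂, by ring⟩
    · exact ⟨u, v, 0, L, hu, hvH, ha, nil ⟨hS, hu⟩, hw, by ring⟩

theorem hit_or_avoid (hp : ∀ u v, G.Adj u v → 0 < ω u v) (h : WalkIn G ω S L u v) (T : Set V) :
    (∃ y ∈ T, ∃ L' ≤ L, WalkIn G ω S L' u y) ∨ WalkIn G ω (S \ T) L u v := by
  induction h with
  | @nil u hu =>
    by_cases hT : u ∈ T
    · exact Or.inl ⟨u, hT, 0, le_rfl, nil hu⟩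
    · exact Or.inr (nil ⟨hu, hT⟩)
  | @cons u v z L hS ha hw ih =>
    by_cases hT : u ∈ T
    · exact Or.inl ⟨u, hT, 0, add_nonneg (hp _ _ ha).le (hw.nonneg hp), nil hS⟩
    · rcases ih with ⟨y, hy, L', hL', h'⟩ | h'
      · exact Or.inl ⟨y, hy, _, by linarith, cons hS ha h'⟩
      · exact Or.inr (cons ⟨hS, hT⟩ ha h')

theorem lipschitz {Φ : V → ℝ} (hΦ : ∀ u v, u ∈ S → v ∈ S → G.Adj u v → Φ u ≤ Φ v + ω u v)
    (h : WalkIn G ω S L u v) : Φ u ≤ Φ v + L := by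
  induction h with
  | nil _ => simp
  | cons hS ha hw ih => linarith [hΦ _ _ hS hw.left_mem ha]

theorem refine_set (h : WalkIn G ω S L u v) (huT : u ∈ T)
    (hT : ∀ a b, a ∈ T → a ∈ S → b ∈ S → G.Adj a b → b ∈ T) : WalkIn G ω (S ∩ T) L u v := by
  induction h with
  | nil hu => exact nil ⟨hu, huT⟩
  | cons hS ha hw ih => exact cons ⟨hS, huT⟩ ha (ih (hT _ _ huT hS hw.left_mem ha))

theorem reachable_induce (h : WalkIn G ω S L u v) :
    (G.induce S).Reachable ⟨u, h.left_mem⟩ ⟨v, h.right_mem⟩ := by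
  induction h with
  | nil _ => exact SimpleGraph.Reachable.refl _
  | cons hS ha hw ih =>
    exact (SimpleGraph.Adj.reachable (by simpa using ha)).trans ih

end WalkIn

/-! ### Shortest-path potentials and their descent pointers. -/

/-- The shortest-path potential: the largest function below `φ` which is Lipschitz along `R`. -/
theorem exists_potential {V : Type*} [Finite V] (R : V → V → Prop) (ω : V → V → ℝ)
    (hω : ∀ u v, R u v → 0 ≤ ω u v) (φ : V → ℝ) :
    ∃ Φ : V → ℝ, (∀ v, Φ v ≤ φ v) ∧ (∀ u v, R u v → Φ u ≤ Φ v + ω u v) ∧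
      (∀ v, Φ v = φ v ∨ ∃ p, R v p ∧ Φ v = Φ p + ω v p) ∧
      ∀ m, (∀ v, m ≤ φ v) → ∀ v, m ≤ Φ v := by
  classical
  let F : Set (V → ℝ) := {Ψ | (∀ v, Ψ v ≤ φ v) ∧ ∀ u v, R u v → Ψ u ≤ Ψ v + ω u v}
  have hconst : ∀ m, (∀ v, m ≤ φ v) → (fun _ => m) ∈ F := fun m hm =>
    ⟨hm, fun u v h => by have := hω u v h; simpa using this⟩
  have hF : F.Nonempty := by
    obtain ⟨m, hm⟩ := (Set.finite_range φ).bddBelow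
    exact ⟨_, hconst m fun v => hm ⟨v, rfl⟩⟩
  have hbdd : ∀ v, BddAbove ((fun Ψ : V → ℝ => Ψ v) '' F) := fun v =>
    ⟨φ v, by rintro _ ⟨Ψ, hΨ, rfl⟩; exact hΨ.1 v⟩
  have hne : ∀ v, ((fun Ψ : V → ℝ => Ψ v) '' F).Nonempty := fun v => hF.image _
  let Φ : V → ℝ := fun v => sSup ((fun Ψ : V → ℝ => Ψ v) '' F)
  have hle : ∀ Ψ ∈ F, ∀ v, Ψ v ≤ Φ v := fun Ψ hΨ v => le_csSup (hbdd v) ⟨Ψ, hΨ, rfl⟩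
  have hΦ : Φ ∈ F := by
    refine ⟨fun v => csSup_le (hne v) ?_, fun u v h => csSup_le (hne u) ?_⟩
    · rintro _ ⟨Ψ, hΨ, rfl⟩; exact hΨ.1 v
    · rintro _ ⟨Ψ, hΨ, rfl⟩
      have := hle Ψ hΨ v
      have := hΨ.2 u v h
      simp only; linarith
  refine ⟨Φ, hΦ.1, hΦ.2, fun v => ?_, fun m hm v => hle _ (hconst m hm) v⟩
  by_contra! hcon
  obtain ⟨h1, h2⟩ := hcon
  have h1' : Φ v < φ v := lt_of_le_of_ne (hΦ.1 v) h1
  have h2' : ∀ p, R v p → Φ v < Φ p + ω v p := fun p hp => lt_of_le_of_ne (hΦ.2 v p hp) (h2 p hp)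
  obtain ⟨b, hb, hb1, hb2⟩ : ∃ b, Φ v < b ∧ b ≤ φ v ∧ ∀ p, R v p → b ≤ Φ p + ω v p := by
    have : Fintype V := Fintype.ofFinite V
    let B : Finset ℝ := insert (φ v) ((Finset.univ.filter (R v)).image fun p => Φ p + ω v p)
    have hB : B.Nonempty := ⟨φ v, by simp [B]⟩
    refine ⟨B.min' hB, ?_, B.min'_le _ (by simp [B]), fun p hp => B.min'_le _ ?_⟩
    · rw [Finset.lt_min'_iff]
      intro y hy
      simp only [B, Finset.mem_insert, Finset.mem_image, Finset.mem_filter, Finset.mem_univ,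
        true_and] at hy
      rcases hy with rfl | ⟨p, hp, rfl⟩
      · exact h1'
      · exact h2' p hp
    · simp only [B, Finset.mem_insert, Finset.mem_image, Finset.mem_filter, Finset.mem_univ,
        true_and]
      exact Or.inr ⟨p, hp, rfl⟩
  -- If nothing is tight at `v`, raising `Φ` at `v` alone stays feasible: the constraints of edges
  -- into `v` only relax. This contradicts maximality.
  have hup : Function.update Φ v b ∈ F := by
    refine ⟨fun u => ?_, fun u u' h => ?_⟩
    · by_cases huv : u = v
      · subst huv; simpa using hb1
      · simpa [huv] using hΦ.1 u
    · by_cases huv : u = v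
      · by_cases huv' : u' = v
        · subst huv; subst huv'; have := hω _ _ h; simpa using this
        · subst huv; simpa [huv'] using hb2 u' h
      · by_cases huv' : u' = v
        · subst huv'; simp only [ne_eq, huv, not_false_eq_true, Function.update_of_ne,
            Function.update_self]
          have := hΦ.2 _ _ h; linarith
        · simpa [huv, huv'] using hΦ.2 u u' h
  have := hle _ hup v
  simp only [Function.update_self] at this
  linarith

/-- Finiteness of `V` makes the comparison of the real values of `Φ` well-founded. -/
theorem descent_induction {V : Type*} [Finite V] {N : Set V} {par : V → V} {Φ : V → ℝ}
    (h : ∀ v ∈ N, Φ (par v) < Φ v) {P : V → Prop} (h0 : ∀ v, v ∉ N → P v)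
    (h1 : ∀ v ∈ N, P (par v) → P v) (v : V) : P v := by
  have wf : WellFounded (fun a b : V => Φ a < Φ b) := by
    have : Std.Irrefl (fun a b : V => Φ a < Φ b) := ⟨fun a => lt_irrefl _⟩
    have : IsTrans V (fun a b : V => Φ a < Φ b) := ⟨fun a b c => lt_trans⟩
    exact Finite.wellFounded_of_trans_of_irrefl _
  induction v using wf.induction with
  | _ v ih =>
    by_cases hv : v ∈ N
    · exact h1 v hv (ih _ (h v hv))
    · exact h0 v hv

/-- Following the pointers `par` from a vertex until `N` is left. -/
theorem exists_root {V : Type*} [Finite V] {N : Set V} {par : V → V} {Φ : V → ℝ}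
    (h : ∀ v ∈ N, Φ (par v) < Φ v) :
    ∃ f : V → V, (∀ v, v ∉ N → f v = v) ∧ (∀ v ∈ N, f v = f (par v)) ∧ ∀ v, f v ∉ N := by
  classical
  have wf : WellFounded (fun a b : V => Φ a < Φ b) := by
    have : Std.Irrefl (fun a b : V => Φ a < Φ b) := ⟨fun a => lt_irrefl _⟩
    have : IsTrans V (fun a b : V => Φ a < Φ b) := ⟨fun a b c => lt_trans⟩
    exact Finite.wellFounded_of_trans_of_irrefl _
  let f : V → V := wf.fix fun v ih => if hv : v ∈ N then ih (par v) (h v hv) else v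
  have hf : ∀ v, f v = if v ∈ N then f (par v) else v := fun v => by
    have := wf.fix_eq (fun v ih => if hv : v ∈ N then ih (par v) (h v hv) else v) v
    simp only [dite_eq_ite] at this
    exact this
  have h0 : ∀ v, v ∉ N → f v = v := fun v hv => by rw [hf, if_neg hv]
  have h1 : ∀ v ∈ N, f v = f (par v) := fun v hv => by rw [hf, if_pos hv]
  refine ⟨f, h0, h1, fun v => ?_⟩
  induction v using descent_induction h with
  | h0 v hv => rwa [h0 v hv]
  | h1 v hv ih => rwa [h1 v hv]

/-- The edge lengths along the pointers telescope to a difference of potentials, and all vertices on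
the way share the root. -/
theorem walkIn_root {V : Type*} [Finite V] {G : SimpleGraph V} {ω : V → V → ℝ} {N : Set V}
    {par : V → V} {Φ : V → ℝ} (h : ∀ v ∈ N, Φ (par v) < Φ v)
    (ha : ∀ v ∈ N, G.Adj v (par v) ∧ Φ v = Φ (par v) + ω v (par v)) {f : V → V}
    (h0 : ∀ v, v ∉ N → f v = v) (h1 : ∀ v ∈ N, f v = f (par v)) (v : V) :
    WalkIn G ω {u | f u = f v} (Φ v - Φ (f v)) v (f v) := by
  induction v using descent_induction h with
  | h0 v hv => 
    have := h0 v hv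
    rw [this, sub_self]
    exact WalkIn.nil (by simp [this])
  | h1 v hv ih =>
    obtain ⟨hadj, hΦ⟩ := ha v hv
    rw [h1 v hv, hΦ, show Φ (par v) + ω v (par v) - Φ (f (par v)) =
      ω v (par v) + (Φ (par v) - Φ (f (par v))) by ring]
    exact WalkIn.cons (by simp [h1 v hv]) hadj ih

/-! ### Buffered cop decompositions: states and invariants. -/

/-- A partial buffered cop decomposition. The supernodes are numbered `0, …, n - 1` in order of
creation, `s v` is the supernode of `v`, and `s v = n` says that `v` is not yet assigned. -/
structure CopState (V : Type*) where
  /-- The number of supernodes. -/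
  n : ℕ
  /-- The supernode that contains a vertex. -/
  s : V → ℕ
  /-- The component of the unassigned part in which a supernode was created. -/
  D : ℕ → Set V
  /-- The older supernodes close to the component in which a supernode was created. -/
  A : ℕ → Finset ℕ
  /-- The endpoints of the branches of the skeleton of a supernode. -/
  X : ℕ → Finset V
  /-- The distance from the root in `D i`. -/
  dist : ℕ → V → ℝ
  /-- The root of a supernode. -/
  root : ℕ → V
  /-- The cluster of a supernode that is given by a branch and a band. -/
  lab : ℕ → V → ℤ → V
  /-- A bound for the distance from a vertex to the skeleton of its supernode. -/
  g : V → ℝ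
  /-- The distance from the root of the skeleton vertex to which a vertex is attached. -/
  β : V → ℝ
  /-- The branch of the skeleton to which a vertex is attached. -/
  q : V → V
  /-- The center of the cluster of a vertex. -/
  c : V → V

namespace CopState

variable {V : Type*}

/-- Supernode `j` is at distance at least one from `u` among the supernodes not older than `j`. -/
def Far (G : SimpleGraph V) (ω : V → V → ℝ) (s : V → ℕ) (j : ℕ) (u : V) : Prop :=
  ∀ L z, WalkIn G ω {v | j ≤ s v} L u z → s z = j → 1 ≤ L

/-- The vertices of the component of `x` in the part where `s` takes the value `n`. -/
def Comp (G : SimpleGraph V) (ω : V → V → ℝ) (s : V → ℕ) (n : ℕ) (x : V) : Set V :=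
  {u | ∃ L, WalkIn G ω {v | s v = n} L x u}

/-- The supernodes that are not far from the unassigned component of `x`. -/
def Near (G : SimpleGraph V) (ω : V → V → ℝ) (s : V → ℕ) (n : ℕ) (x : V) : Set ℕ :=
  {l | l < n ∧ ∃ u ∈ Comp G ω s n x, ¬ Far G ω s l u}

/-- The number of supernodes older than `k` that are not far from the component of `x`. -/
noncomputable def nearCount (G : SimpleGraph V) (ω : V → V → ℝ) (s : V → ℕ) (n k : ℕ) (x : V) :
    ℕ :=
  {l | l < k ∧ l ∈ Near G ω s n x}.ncard

/-- The invariants of the construction of a buffered cop decomposition. -/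
structure Valid (G : SimpleGraph V) (ω : V → V → ℝ) (r : ℕ) (ℓ : ℝ) (σ : CopState V) : Prop where
  le_n : ∀ v, σ.s v ≤ σ.n
  mem_D : ∀ v, σ.s v < σ.n → v ∈ σ.D (σ.s v)
  D_closed : ∀ i u v, i < σ.n → u ∈ σ.D i → G.Adj u v → i ≤ σ.s v → v ∈ σ.D i
  conn : ∀ v, σ.s v < σ.n → ∃ L, WalkIn G ω {u | σ.s u = σ.s v} L v (σ.root (σ.s v))
  -- Supernodes touching a common unassigned component are adjacent; this is the source of clique
  -- minors.
  clique : ∀ x x' y y', σ.s x = σ.n → x' ∈ Comp G ω σ.s σ.n x → G.Adj x y → G.Adj x' y' →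
    σ.s y < σ.n → σ.s y' < σ.n → σ.s y ≠ σ.s y' →
      ∃ a b, σ.s a = σ.s y ∧ σ.s b = σ.s y' ∧ G.Adj a b
  card_A : ∀ i, i < σ.n → (σ.A i).card < r
  far : ∀ i j u, i < σ.n → j < i → j ∉ σ.A i → u ∈ σ.D i → i ≤ σ.s u → Far G ω σ.s j u
  -- Growth so far plus `r + 1` for each older supernode still near the component: every future
  -- growth is paid for by one of these.
  budget : ∀ x y, σ.s x = σ.n → σ.s y < σ.n → G.Adj x y →
    σ.g y + (r + 1) * nearCount G ω σ.s σ.n (σ.s y) x ≤ (r + 1) * r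
  g_nonneg : ∀ v, σ.s v < σ.n → 0 ≤ σ.g v
  g_le : ∀ v, σ.s v < σ.n → σ.g v ≤ (r + 1) * r
  lip : ∀ i u v, i < σ.n → u ∈ σ.D i → v ∈ σ.D i → G.Adj u v → σ.dist i u ≤ σ.dist i v + ω u v
  beta : ∀ v, σ.s v < σ.n → |σ.β v - σ.dist (σ.s v) v| ≤ σ.g v
  q_mem : ∀ v, σ.s v < σ.n → σ.q v ∈ σ.X (σ.s v)
  label : ∀ v, σ.s v < σ.n → σ.c v = σ.lab (σ.s v) (σ.q v) ⌊σ.β v / ℓ⌋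
  card_X : ∀ i, i < σ.n → (σ.X i).card ≤ r
  cluster : ∀ v, σ.s v < σ.n → ∃ L ≤ ℓ + σ.g v,
    WalkIn G ω {u | σ.s u = σ.s v ∧ σ.c u = σ.c v} L v (σ.c v)

section

variable {G : SimpleGraph V} {ω : V → V → ℝ} {s : V → ℕ} {n : ℕ} {x u v : V}

theorem self_mem_comp (hx : s x = n) : x ∈ Comp G ω s n x := ⟨0, WalkIn.nil hx⟩

theorem s_of_mem_comp (h : u ∈ Comp G ω s n x) : s u = n := h.elim fun _ h => h.right_mem

theorem comp_closed (hu : u ∈ Comp G ω s n x) (ha : G.Adj u v) (hv : s v = n) :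
    v ∈ Comp G ω s n x := by
  obtain ⟨L, h⟩ := hu
  exact ⟨_, h.trans (WalkIn.single h.right_mem hv ha)⟩

theorem walkIn_comp {L : ℝ} (h : WalkIn G ω {v | s v = n} L u v) (hu : u ∈ Comp G ω s n x) :
    WalkIn G ω (Comp G ω s n x) L u v :=
  (h.refine_set hu fun _ _ ha _ hb hab => comp_closed ha hab hb).mono Set.inter_subset_right

theorem comp_eq (hω : ∀ u v, ω u v = ω v u) (hu : u ∈ Comp G ω s n x) :
    Comp G ω s n u = Comp G ω s n x := by
  obtain ⟨L, h⟩ := hu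
  ext z
  exact ⟨fun ⟨L', h'⟩ => ⟨_, h.trans h'⟩, fun ⟨L', h'⟩ => ⟨_, (h.symm hω).trans h'⟩⟩

theorem near_eq (hω : ∀ u v, ω u v = ω v u) (hu : u ∈ Comp G ω s n x) :
    Near G ω s n u = Near G ω s n x := by
  unfold Near; rw [comp_eq hω hu]

theorem adj_comp_assigned (hs : ∀ v, s v ≤ n) (hu : u ∈ Comp G ω s n x) (ha : G.Adj u v)
    (hv : v ∉ Comp G ω s n x) : s v < n :=
  lt_of_le_of_ne (hs v) fun h => hv (comp_closed hu ha h)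

end

end CopState

theorem CliqueMinorFree.card_lt {V : Type*} {G : SimpleGraph V} {r : ℕ} (h : CliqueMinorFree r G)
    {U : Type*} [Fintype U] (B : MinorModel (⊤ : SimpleGraph U) G) : Fintype.card U < r := by
  by_contra! hle
  obtain ⟨e⟩ : Nonempty (Fin r ↪ U) :=
    Function.Embedding.nonempty_of_card_le (by simpa using hle)
  exact h ⟨⟨fun i => B.branch (e i), fun i => B.connected _,
    fun i j hij => B.disjoint _ _ (e.injective.ne hij),
    fun i j hij => B.adj _ _ (by simpa using hij)⟩⟩

theorem induce_connected {V : Type*} {G : SimpleGraph V} {ω : V → V → ℝ} {S : Set V} (ρ : V)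
    (hρ : S.Nonempty) (h : ∀ v ∈ S, ∃ L, WalkIn G ω S L v ρ) : (G.induce S).Connected := by
  obtain ⟨v0, hv0⟩ := hρ
  have : Nonempty S := ⟨⟨v0, hv0⟩⟩
  refine ⟨fun u v => ?_⟩
  obtain ⟨L, hL⟩ := h u u.2
  obtain ⟨L', hL'⟩ := h v v.2
  exact hL.reachable_induce.trans hL'.reachable_induce.symm

namespace CopState

variable {V : Type*} {G : SimpleGraph V} {ω : V → V → ℝ} {r : ℕ} {ℓ : ℝ} {σ : CopState V}

/-- By the invariant `clique`, the component and the supernodes in `F` are the branch sets of a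
complete minor on `F.card + 1` vertices. -/
theorem Valid.card_adjacent_lt (hσ : σ.Valid G ω r ℓ) (hω : ∀ u v, ω u v = ω v u)
    (hG : CliqueMinorFree r G) {x : V}
    (hx : σ.s x = σ.n) (F : Finset ℕ) (hF : ∀ k ∈ F, k < σ.n ∧
      ∃ u ∈ Comp G ω σ.s σ.n x, ∃ y, G.Adj u y ∧ σ.s y = k) : F.card + 1 < r := by
  classical
  have hcomp : (G.induce (Comp G ω σ.s σ.n x)).Connected :=
    induce_connected (ω := ω) x ⟨x, self_mem_comp hx⟩ fun v ⟨L, hv⟩ =>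
      ⟨L, (walkIn_comp hv (self_mem_comp hx)).symm hω⟩
  have : Nonempty V := ⟨x⟩
  choose! hk u hu y huy hy using hF
  have hn : ∀ (k : F) v, v ∈ Comp G ω σ.s σ.n x → σ.s v ≠ (k : ℕ) := fun k v hv hvk => by
    have := s_of_mem_comp hv
    have := hk k k.2
    omega
  let B : MinorModel (⊤ : SimpleGraph (Option F)) G :=
    { branch := fun o => o.elim (Comp G ω σ.s σ.n x) fun k => {v | σ.s v = k}
      connected := by
        rintro (_ | k)
        · exact hcomp
        · refine induce_connected (ω := ω) (σ.root k) ⟨y k, hy k k.2⟩ fun v hv => ?_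
          simp only [Option.elim_some, Set.mem_ofPred_eq] at hv
          have := hσ.conn v (hv ▸ hk k k.2)
          simpa [hv] using this
      disjoint := by
        rintro (_ | k) (_ | k') hne
        · exact absurd rfl hne
        · exact Set.disjoint_left.2 fun v hv hv' => hn k' v hv hv'
        · exact Set.disjoint_left.2 fun v hv hv' => hn k v hv' hv
        · refine Set.disjoint_left.2 fun v hv hv' => hne ?_
          simp only [Option.elim_some, Set.mem_ofPred_eq] at hv hv'
          rw [show k = k' from Subtype.ext (hv.symm.trans hv')]
      adj := by
        rintro (_ | k) (_ | k') hne
        · simp at hne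
        · exact ⟨u k', hu k' k'.2, y k', hy k' k'.2, huy k' k'.2⟩
        · exact ⟨y k, hy k k.2, u k, hu k k.2, (huy k k.2).symm⟩
        · have hkk : (k : ℕ) ≠ k' := fun h => by simp [Subtype.ext h] at hne
          obtain ⟨a, b, ha, hb, hab⟩ := hσ.clique (u k) (u k') (y k) (y k')
            (s_of_mem_comp (hu k k.2)) (by rw [comp_eq hω (hu k k.2)]; exact hu k' k'.2)
            (huy k k.2) (huy k' k'.2) (by rw [hy k k.2]; exact hk k k.2)
            (by rw [hy k' k'.2]; exact hk k' k'.2) (by rwa [hy k k.2, hy k' k'.2])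
          exact ⟨a, ha.trans (hy k k.2), b, hb.trans (hy k' k'.2), hab⟩ }
  simpa using hG.card_lt B

end CopState

/-! ### Growing supernodes to restore the buffer. -/

namespace CopState

variable {V : Type*} {G : SimpleGraph V} {ω : V → V → ℝ}

/-- The supernodes of `E` grow into the unassigned component of `x₀`: the vertex `v` is absorbed by
the supernode of `f v`, and `Φ` is the shortest-path potential where the supernodes of `E` start
with a handicap that decreases with their age. -/
structure IsGrowth (G : SimpleGraph V) (ω : V → V → ℝ) (s : V → ℕ) (n : ℕ) (x₀ : V)
    (E : Finset ℕ) (f : V → V) (Φ : V → ℝ) : Prop where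
  eq_self : ∀ v, v ∉ Comp G ω s n x₀ → f v = v
  moved : ∀ v, f v ≠ v → v ∈ Comp G ω s n x₀ ∧ s (f v) ∈ E ∧ Φ v < 1 ∧
    Φ (f v) = -((E.filter (· < s (f v))).card : ℝ) ∧ ∃ x ∈ Comp G ω s n x₀, G.Adj x (f v)
  idem : ∀ v, f (f v) = f v
  walk : ∀ v, WalkIn G ω {u | f u = f v} (Φ v - Φ (f v)) v (f v)
  le : ∀ L v x y, WalkIn G ω (Comp G ω s n x₀) L v x → G.Adj x y → s y ∈ E →
    Φ v ≤ L + ω x y - ((E.filter (· < s y)).card : ℝ)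
  one_le : ∀ v, v ∈ Comp G ω s n x₀ → f v = v → 1 ≤ Φ v

theorem exists_isGrowth [Finite V] (hω : ∀ u v, G.Adj u v → 0 < ω u v) {s : V → ℕ} {n : ℕ} (x₀ : V)
    {E : Finset ℕ} (hE : ∀ k ∈ E, k < n) : ∃ f Φ, IsGrowth G ω s n x₀ E f Φ := by
  classical
  set H := Comp G ω s n x₀ with hH
  have hHE : ∀ v ∈ H, s v ∉ E := fun v hv hvE => by
    have := s_of_mem_comp hv
    have := hE _ hvE
    omega
  let o : ℕ → ℝ := fun k => ((E.filter (· < k)).card : ℝ)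
  -- No edge of `R` leaves a supernode of `E`, so these keep their starting values `-o`. The cap `1`
  -- elsewhere is the buffer width: exactly the vertices of `H` below it are absorbed.
  let R : V → V → Prop := fun u v => G.Adj u v ∧ u ∈ H ∧ (v ∈ H ∨ s v ∈ E)
  obtain ⟨Φ, hφ, hlip, htight, -⟩ := exists_potential R ω (fun u v h => (hω u v h.1).le)
    (fun v => if s v ∈ E then -o (s v) else 1)
  have hsrc : ∀ v, s v ∈ E → Φ v = -o (s v) := fun v hv => by
    rcases htight v with h | ⟨p, hp, -⟩
    · simpa [hv] using h
    · exact absurd hv (hHE v hp.2.1)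
  let N : Set V := {v | v ∈ H ∧ Φ v < 1}
  have hpar : ∀ v, ∃ p, v ∈ N → R v p ∧ Φ v = Φ p + ω v p := fun v => by
    by_cases hv : v ∈ N
    · rcases htight v with h | ⟨p, hp, h⟩
      · rw [if_neg (hHE v hv.1)] at h
        exact absurd h hv.2.ne
      · exact ⟨p, fun _ => ⟨hp, h⟩⟩
    · exact ⟨v, fun h => absurd h hv⟩
  choose par hpar using hpar
  have hlt : ∀ v ∈ N, Φ (par v) < Φ v := fun v hv => by
    have := hpar v hv
    have := hω _ _ this.1.1
    linarith
  obtain ⟨f, h0, h1, h2⟩ := exists_root hlt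
  have hparN : ∀ v ∈ N, par v ∉ N → s (par v) ∈ E := fun v hv hp => by
    rcases (hpar v hv).1.2.2 with h | h
    · exact absurd ⟨h, (hlt v hv).trans hv.2⟩ hp
    · exact h
  have hmoved : ∀ v, v ∈ N → s (f v) ∈ E ∧ ∃ x ∈ H, G.Adj x (f v) := fun v => by
    induction v using descent_induction hlt with
    | h0 v hv => exact fun h => absurd h hv
    | h1 v hv ih =>
      intro _
      by_cases hp : par v ∈ N
      · rw [h1 v hv]; exact ih hp
      · rw [h1 v hv, h0 _ hp]
        exact ⟨hparN v hv hp, v, hv.1, (hpar v hv).1.1⟩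
  have hne : ∀ v, f v ≠ v → v ∈ N := fun v hv => by_contra fun h => hv (h0 v h)
  refine ⟨f, Φ, ⟨fun v hv => h0 v fun h => hv h.1, fun v hv => ?_, fun v => h0 _ (h2 v), ?_, ?_, ?_⟩⟩
  · obtain ⟨h3, h4⟩ := hmoved v (hne v hv)
    exact ⟨(hne v hv).1, h3, (hne v hv).2, hsrc _ h3, h4⟩
  · exact walkIn_root hlt (fun v hv => ⟨(hpar v hv).1.1, (hpar v hv).2⟩) h0 h1
  · intro L v x y hw hxy hy
    have e1 : Φ v ≤ Φ x + L := hw.lipschitz fun a b ha hb hab => hlip a b ⟨hab, ha, Or.inl hb⟩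
    have e2 : Φ x ≤ Φ y + ω x y := hlip x y ⟨hxy, hw.right_mem, Or.inr hy⟩
    rw [hsrc y hy] at e2
    simp only [o] at e2
    linarith
  · intro v hv hfv
    by_contra! hlt1
    exact h2 v (by rw [hfv]; exact ⟨hv, hlt1⟩)

/-- The set `E` consists of the supernodes younger than `i` that are adjacent to the unassigned
component of `x₀` and not far from it. -/
def IsEligible (G : SimpleGraph V) (ω : V → V → ℝ) (s : V → ℕ) (n : ℕ) (x₀ : V) (i : ℕ)
    (E : Finset ℕ) : Prop :=
  ∀ k, k ∈ E ↔ i < k ∧ k < n ∧ k ∈ Near G ω s n x₀ ∧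
    ∃ u ∈ Comp G ω s n x₀, ∃ y, G.Adj u y ∧ s y = k

namespace IsGrowth

variable {s : V → ℕ} {n i : ℕ} {x₀ : V} {E : Finset ℕ} {f : V → V} {Φ : V → ℝ}

theorem apply_lt (h : IsGrowth G ω s n x₀ E f Φ) (hE : IsEligible G ω s n x₀ i E) {v : V}
    (hv : f v ≠ v) : s (f v) < n := ((hE _).1 (h.moved v hv).2.1).2.1

theorem eq_of_apply_eq (h : IsGrowth G ω s n x₀ E f Φ) (hE : IsEligible G ω s n x₀ i E) {v : V}
    (hv : s (f v) = n) : f v = v := by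
  by_contra hne
  have := h.apply_lt hE hne
  omega

theorem eq_of_lt (h : IsGrowth G ω s n x₀ E f Φ) {v : V} (hv : s v < n) : f v = v :=
  h.eq_self v fun hc => by have := s_of_mem_comp hc; omega

theorem apply_le (h : IsGrowth G ω s n x₀ E f Φ) (hE : IsEligible G ω s n x₀ i E) (v : V) :
    s (f v) ≤ s v := by
  by_cases hv : f v = v
  · rw [hv]
  · have := h.apply_lt hE hv
    have := s_of_mem_comp (h.moved v hv).1
    omega

/-- A walk leaves the component through an adjacent supernode. If that one is not near, the walk is
long by the buffer; otherwise it is eligible and bounds the potential. -/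
theorem exit_ge (h : IsGrowth G ω s n x₀ E f Φ) (hE : IsEligible G ω s n x₀ i E)
    (hs : ∀ v, s v ≤ n) {L : ℝ} {v x y : V} (hv : v ∈ Comp G ω s n x₀)
    (hw : WalkIn G ω (Comp G ω s n x₀) L v x) (hxy : G.Adj x y) (hy : y ∉ Comp G ω s n x₀)
    (hi : i < s y) :
    1 ≤ L + ω x y ∨ (s y ∈ E ∧ Φ v ≤ L + ω x y - ((E.filter (· < s y)).card : ℝ)) := by
  have hlt := adj_comp_assigned hs hw.right_mem hxy hy
  by_cases hN : s y ∈ Near G ω s n x₀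
  · have hyE : s y ∈ E := (hE _).2 ⟨hi, hlt, hN, x, hw.right_mem, y, hxy, rfl⟩
    exact Or.inr ⟨hyE, h.le L v x y hw hxy hyE⟩
  · left
    have hfar : Far G ω s (s y) v := by_contra fun hc => hN ⟨hlt, v, hv, hc⟩
    refine hfar _ y ((hw.mono fun u hu => ?_).trans (WalkIn.single ?_ ?_ hxy)) rfl
    · have := s_of_mem_comp hu
      simp only [Set.mem_ofPred_eq]; omega
    · have := s_of_mem_comp hw.right_mem
      simp only [Set.mem_ofPred_eq]; omega
    · simp

/-- This is what the head starts are for. A walk to a vertex newly absorbed by `j` that avoids the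
old `j` must enter the component through a younger supernode. That supernode is either not near, or
has a head start at least one larger than that of `j`, so it would have won unless the walk has
length at least one. -/
theorem far_of_notMem (h : IsGrowth G ω s n x₀ E f Φ) (hE : IsEligible G ω s n x₀ i E)
    (hω : ∀ u v, G.Adj u v → 0 < ω u v) (hsymm : ∀ u v, ω u v = ω v u)
    (hs : ∀ v, s v ≤ n) {j : ℕ} {u : V} (hu : u ∉ Comp G ω s n x₀) (hfar : Far G ω s j u) :
    Far G ω (s ∘ f) j u := by
  intro L z hw hz
  simp only [Function.comp_apply] at hw hz
  have hw' : WalkIn G ω {v | j ≤ s v} L u z := hw.mono fun v hv => le_trans hv (h.apply_le hE v)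
  rcases hw'.hit_or_avoid hω {v | s v = j} with ⟨y, hy, L', hL', h'⟩ | hav
  · exact (hfar L' y h' hy).trans hL'
  have hzj : s z ≠ j := hav.right_mem.2
  have hfz : f z ≠ z := fun hc => hzj (by rw [hc] at hz; exact hz)
  obtain ⟨hzH, hzE, -, hΦ, -⟩ := h.moved z hfz
  obtain ⟨x, y, L₁, L₂, hx, hy, hxy, w₁, w₂, rfl⟩ := (hav.symm hsymm).first_exit hzH hu
  have hy' := w₂.left_mem
  have hjy : j < s y := lt_of_le_of_ne hy'.1 (Ne.symm hy'.2)
  have hL₂ := w₂.nonneg hω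
  have hij : i < j := by have := ((hE _).1 hzE).1; omega
  rcases h.exit_ge hE hs hzH (w₁.mono Set.inter_subset_right) hxy hy (hij.trans hjy) with
    h1 | ⟨hyE, h1⟩
  · linarith
  · have h2 := (h.walk z).nonneg hω
    rw [hΦ, hz] at h2
    have h3 : (E.filter (· < j)).card + 1 ≤ (E.filter (· < s y)).card := by
      rw [hz] at hzE
      apply Finset.card_lt_card
      rw [Finset.ssubset_iff]
      refine ⟨j, by simp, fun k hk => ?_⟩
      simp only [Finset.mem_insert, Finset.mem_filter] at hk ⊢
      rcases hk with rfl | ⟨hk1, hk2⟩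
      · exact ⟨hzE, hjy⟩
      · exact ⟨hk1, hk2.trans hjy⟩
    have h4 : ((E.filter (· < j)).card : ℝ) + 1 ≤ ((E.filter (· < s y)).card : ℝ) := by
      exact_mod_cast h3
    linarith

/-- Such a `j` is not eligible and absorbs nothing, while the region allowed to walks only shrinks.
-/
theorem far_of_notMem_near (h : IsGrowth G ω s n x₀ E f Φ) (hE : IsEligible G ω s n x₀ i E)
    {j : ℕ} {u : V} (hj : j ∉ Near G ω s n x₀) (hfar : Far G ω s j u) :
    Far G ω (s ∘ f) j u := by
  intro L z hw hz
  have hfz : f z = z := by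
    by_contra hne
    have := (hE _).1 (h.moved z hne).2.1
    simp only [Function.comp_apply] at hz
    rw [hz] at this
    exact hj this.2.2.1
  exact hfar L z (hw.mono fun v hv => le_trans hv (h.apply_le hE v))
    (by simpa [hfz] using hz)

theorem comp_subset (h : IsGrowth G ω s n x₀ E f Φ) (hE : IsEligible G ω s n x₀ i E) (x : V) :
    Comp G ω (s ∘ f) n x ⊆ Comp G ω s n x := fun _ ⟨L, hw⟩ =>
  ⟨L, hw.mono fun v hv => by
    have hv' : s (f v) = n := hv
    rw [h.eq_of_apply_eq hE hv'] at hv'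
    exact hv'⟩

theorem near_subset (h : IsGrowth G ω s n x₀ E f Φ) (hE : IsEligible G ω s n x₀ i E)
    (hω : ∀ u v, G.Adj u v → 0 < ω u v) (hsymm : ∀ u v, ω u v = ω v u)
    (hs : ∀ v, s v ≤ n) (x : V) : Near G ω (s ∘ f) n x ⊆ Near G ω s n x := by
  rintro l ⟨hl, u, hu, hfar⟩
  by_contra hcon
  have hu' := h.comp_subset hE x hu
  have hfar' : Far G ω s l u := by_contra fun hc => hcon ⟨hl, u, hu', hc⟩
  by_cases hu0 : u ∈ Comp G ω s n x₀
  · refine hfar (h.far_of_notMem_near hE ?_ hfar')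
    rwa [← near_eq hsymm hu0, near_eq hsymm hu']
  · exact hfar (h.far_of_notMem hE hω hsymm hs hu0 hfar')

/-- Since `i` does not touch the component, a walk towards it leaves through a younger supernode.
Vertices that remain unassigned have potential at least one, so this exit is already that long. -/
theorem notMem_near (h : IsGrowth G ω s n x₀ E f Φ) (hE : IsEligible G ω s n x₀ i E)
    (hω : ∀ u v, G.Adj u v → 0 < ω u v) (hsymm : ∀ u v, ω u v = ω v u)
    (hs : ∀ v, s v ≤ n) (hi : ∀ u ∈ Comp G ω s n x₀, ∀ y, G.Adj u y → s y ≠ i)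
    {x : V} (hx : x ∈ Comp G ω s n x₀) : i ∉ Near G ω (s ∘ f) n x := by
  rintro ⟨hin, u, hu, hfar⟩
  refine hfar fun L z hw hz => ?_
  have hfu : f u = u := h.eq_of_apply_eq hE (s_of_mem_comp (s := s ∘ f) hu)
  have hu0 : u ∈ Comp G ω s n x₀ := by
    rw [← comp_eq hsymm hx]; exact h.comp_subset hE x hu
  have hfz : f z = z := by
    by_contra hne
    have := ((hE _).1 (h.moved z hne).2.1).1
    simp only [Function.comp_apply] at hz
    omega
  have hz0 : z ∉ Comp G ω s n x₀ := fun hc => by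
    have := s_of_mem_comp hc
    simp only [Function.comp_apply, hfz] at hz
    omega
  obtain ⟨x', y, L₁, L₂, hx', hy, hxy, w₁, w₂, rfl⟩ := hw.first_exit hu0 hz0
  have hL₂ := w₂.nonneg hω
  have hiy : i < s y :=
    lt_of_le_of_ne (le_trans w₂.left_mem (h.apply_le hE y)) (hi x' hx' y hxy).symm
  rcases h.exit_ge hE hs hu0 (w₁.mono Set.inter_subset_right) hxy hy hiy with h1 | ⟨-, h1⟩
  · linarith
  · have := h.one_le u hu0 hfu
    have h5 : (0 : ℝ) ≤ ((E.filter (· < s y)).card : ℝ) := Nat.cast_nonneg _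
    linarith

/-- Progress: a short walk witnessing that `i` is near passes through a younger supernode, so its
first vertex has potential below one and is absorbed. -/
theorem exists_moved (h : IsGrowth G ω s n x₀ E f Φ) (hE : IsEligible G ω s n x₀ i E)
    (hω : ∀ u v, G.Adj u v → 0 < ω u v)
    (hs : ∀ v, s v ≤ n) (hi : ∀ u ∈ Comp G ω s n x₀, ∀ y, G.Adj u y → s y ≠ i)
    (hi' : i ∈ Near G ω s n x₀) : ∃ v, s v = n ∧ s (f v) < n := by
  obtain ⟨hin, u, hu, hfar⟩ := hi'
  unfold Far at hfar
  push Not at hfar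
  obtain ⟨L, z, hw, hz, hL⟩ := hfar
  have hz0 : z ∉ Comp G ω s n x₀ := fun hc => by
    have := s_of_mem_comp hc
    omega
  obtain ⟨x', y, L₁, L₂, hx', hy, hxy, w₁, w₂, rfl⟩ := hw.first_exit hu hz0
  have hL₂ := w₂.nonneg hω
  have hiy : i < s y := lt_of_le_of_ne w₂.left_mem (hi x' hx' y hxy).symm
  refine ⟨u, s_of_mem_comp hu, ?_⟩
  rcases h.exit_ge hE hs hu (w₁.mono Set.inter_subset_right) hxy hy hiy with h1 | ⟨-, h1⟩
  · linarith
  · refine h.apply_lt hE fun hfu => ?_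
    have := h.one_le u hu hfu
    have h5 : (0 : ℝ) ≤ ((E.filter (· < s y)).card : ℝ) := Nat.cast_nonneg _
    linarith

end IsGrowth

theorem nearCount_mono {s s' : V → ℕ} {n n' k : ℕ} {x x' : V}
    (h : ∀ l, l < k → l ∈ Near G ω s' n' x' → l ∈ Near G ω s n x) :
    nearCount G ω s' n' k x' ≤ nearCount G ω s n k x :=
  Set.ncard_le_ncard (fun l hl => ⟨hl.1, h l hl.1 hl.2⟩) ((Set.finite_lt_nat k).subset fun _ h => h.1)

theorem nearCount_lt {s s' : V → ℕ} {n n' k i : ℕ} {x x' : V}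
    (h : ∀ l, l < k → l ∈ Near G ω s' n' x' → l ∈ Near G ω s n x) (hik : i < k)
    (hi : i ∈ Near G ω s n x) (hi' : i ∉ Near G ω s' n' x') :
    nearCount G ω s' n' k x' + 1 ≤ nearCount G ω s n k x :=
  Set.ncard_lt_ncard ⟨fun l hl => ⟨hl.1, h l hl.1 hl.2⟩, fun hc => hi' (hc ⟨hik, hi⟩).2⟩
    ((Set.finite_lt_nat k).subset fun _ h => h.1)

/-- The domains `D i` are closed under edges to unassigned vertices, so each contains an unassigned
component entirely or misses it. -/
theorem Valid.comp_subset_D {r : ℕ} {ℓ : ℝ} {σ : CopState V} (hσ : σ.Valid G ω r ℓ)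
    (hsymm : ∀ u v, ω u v = ω v u)
    {i : ℕ} (hi : i < σ.n) {x u v : V} (hu : u ∈ Comp G ω σ.s σ.n x) (huD : u ∈ σ.D i)
    (hv : v ∈ Comp G ω σ.s σ.n x) : v ∈ σ.D i := by
  rw [← comp_eq hsymm hu] at hv
  obtain ⟨L, hw⟩ := hv
  exact (hw.refine_set huD fun a b ha _ hb hab =>
    hσ.D_closed i a b hi ha hab (by rw [show σ.s b = σ.n from hb]; exact hi.le)).right_mem.2

/-- The supernodes younger than `i` absorb all vertices of potential below one. Afterwards `i` is no
longer near, which pays for the growth in `budget`. -/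
theorem Valid.exists_grow [Finite V] {r : ℕ} {ℓ : ℝ} {σ : CopState V} (hσ : σ.Valid G ω r ℓ)
    (hω : ∀ u v, G.Adj u v → 0 < ω u v) (hsymm : ∀ u v, ω u v = ω v u)
    (hG : CliqueMinorFree r G) {x₀ : V} (hx₀ : σ.s x₀ = σ.n) {i : ℕ}
    (hi' : i ∈ Near G ω σ.s σ.n x₀)
    (hi : ∀ u ∈ Comp G ω σ.s σ.n x₀, ∀ y, G.Adj u y → σ.s y ≠ i) :
    ∃ τ : CopState V, τ.Valid G ω r ℓ ∧ {v | τ.s v = τ.n} ⊂ {v | σ.s v = σ.n} := by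
  classical
  let E : Finset ℕ := (Finset.range σ.n).filter fun k => i < k ∧ k < σ.n ∧
    k ∈ Near G ω σ.s σ.n x₀ ∧ ∃ u ∈ Comp G ω σ.s σ.n x₀, ∃ y, G.Adj u y ∧ σ.s y = k
  have hE : IsEligible G ω σ.s σ.n x₀ i E := fun k => by simp [E]; tauto
  obtain ⟨f, Φ, h⟩ := exists_isGrowth hω x₀ (s := σ.s) (n := σ.n) (E := E)
    fun k hk => ((hE k).1 hk).2.1
  have hEr : E.card + 1 < r := hσ.card_adjacent_lt hsymm hG hx₀ E fun k hk =>
    ⟨((hE k).1 hk).2.1, ((hE k).1 hk).2.2.2⟩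
  have hle := hσ.le_n
  have hnear := h.near_subset hE hω hsymm hle
  have hfix : ∀ u v, σ.s v < σ.n → σ.s u = σ.s v → f u = u := fun u v hv huv =>
    h.eq_of_lt (by omega)
  have hmemD : ∀ v, σ.s (f v) < σ.n → v ∈ σ.D (σ.s (f v)) := fun v hv => by
    by_cases hfv : f v = v
    · rw [hfv] at hv ⊢; exact hσ.mem_D v hv
    · obtain ⟨hvH, -, -, -, x, hx, hxf⟩ := h.moved v hfv
      refine hσ.comp_subset_D hsymm hv hx ?_ hvH
      exact hσ.D_closed _ (f v) x hv (hσ.mem_D _ hv) hxf.symm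
        (by rw [s_of_mem_comp hx]; exact hv.le)
  have hwalk : ∀ v, 0 ≤ Φ v - Φ (f v) := fun v => (h.walk v).nonneg hω
  -- a grown vertex next to an unassigned one
  have hgrown : ∀ x y, σ.s (f x) = σ.n → f y ≠ y → G.Adj x y → x ∈ Comp G ω σ.s σ.n x₀ :=
    fun x y hx hy hxy => by
      have hfx := h.eq_of_apply_eq hE hx
      rw [hfx] at hx
      exact comp_closed (h.moved y hy).1 hxy.symm hx
  have hadj : ∀ x y, σ.s (f x) = σ.n → G.Adj x y →
      ∃ x₁ ∈ Comp G ω σ.s σ.n x, G.Adj x₁ (f y) := fun x y hx hxy => by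
    by_cases hy : f y = y
    · have hfx := h.eq_of_apply_eq hE hx
      rw [hfx] at hx
      exact ⟨x, self_mem_comp hx, by rwa [hy]⟩
    · rw [comp_eq hsymm (hgrown x y hx hy hxy)]
      exact (h.moved y hy).2.2.2.2
  -- The potential ends below `1` and starts at minus a rank, which is at most `r`.
  have hstep : ∀ v, f v ≠ v → Φ v - Φ (f v) ≤ r + 1 := fun v hv => by
    obtain ⟨-, -, h1, h2, -⟩ := h.moved v hv
    have h3 : (E.filter (· < σ.s (f v))).card ≤ r := (Finset.card_filter_le _ _).trans (by omega)
    have h4 : ((E.filter (· < σ.s (f v))).card : ℝ) ≤ r := by exact_mod_cast h3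
    rw [h2]; linarith
  have hnc : ∀ v x, f v ≠ v → x ∈ Comp G ω σ.s σ.n x₀ →
      (nearCount G ω (σ.s ∘ f) σ.n (σ.s (f v)) x : ℝ) + 1 ≤
        nearCount G ω σ.s σ.n (σ.s (f v)) x₀ := fun v x hv hx => by
    rw [← near_eq hsymm hx] at hi'
    have e : nearCount G ω σ.s σ.n (σ.s (f v)) x₀ = nearCount G ω σ.s σ.n (σ.s (f v)) x := by
      simp only [nearCount, near_eq hsymm hx]
    rw [e]
    exact_mod_cast nearCount_lt (fun l _ hl => hnear x hl) ((hE _).1 (h.moved v hv).2.1).1 hi'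
      (h.notMem_near hE hω hsymm hle hi hx)
  have hbud : ∀ v, f v ≠ v → σ.g (f v) + (r + 1) * nearCount G ω σ.s σ.n (σ.s (f v)) x₀ ≤
      (r + 1) * r := fun v hv => by
    obtain ⟨-, -, -, -, x, hx, hxf⟩ := h.moved v hv
    have := hσ.budget x (f v) (s_of_mem_comp hx) (h.apply_lt hE hv) hxf
    have e : nearCount G ω σ.s σ.n (σ.s (f v)) x₀ = nearCount G ω σ.s σ.n (σ.s (f v)) x := by
      simp only [nearCount, near_eq hsymm hx]
    rwa [e]
  let τ : CopState V :=
    { σ with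
      s := σ.s ∘ f, g := fun v => σ.g (f v) + (Φ v - Φ (f v)), β := σ.β ∘ f, q := σ.q ∘ f,
      c := σ.c ∘ f }
  refine ⟨τ, ?_, ?_⟩
  · constructor
    · exact fun v => hle _
    · exact hmemD
    · exact fun i u v hi hu huv hv => hσ.D_closed i u v hi hu huv (hv.trans (h.apply_le hE v))
    · intro v hv
      obtain ⟨L, hL⟩ := hσ.conn (f v) hv
      refine ⟨_, ((h.walk v).mono fun u hu => ?_).trans (hL.mono fun u hu => ?_)⟩
      · exact congrArg σ.s hu
      · have hu' : σ.s u = σ.s (f v) := hu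
        change σ.s (f u) = σ.s (f v)
        rw [hfix u (f v) hv hu', hu']
    · intro x x' y y' hx hx' hxy hxy' hy hy' hne
      obtain ⟨x₁, hx₁, ha₁⟩ := hadj x y hx hxy
      obtain ⟨x₂, hx₂, ha₂⟩ := hadj x' y' (s_of_mem_comp (s := σ.s ∘ f) hx') hxy'
      have hxx' := h.comp_subset hE x hx'
      rw [comp_eq hsymm hxx', ← comp_eq hsymm hx₁] at hx₂
      obtain ⟨a, b, ha, hb, hab⟩ := hσ.clique x₁ x₂ (f y) (f y') (s_of_mem_comp hx₁) hx₂ ha₁ ha₂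
        hy hy' hne
      refine ⟨a, b, ?_, ?_, hab⟩
      · change σ.s (f a) = _; rw [hfix a (f y) hy ha, ha]; rfl
      · change σ.s (f b) = _; rw [hfix b (f y') hy' hb, hb]; rfl
    · exact hσ.card_A
    · intro k j u hk hjk hj hu hku
      have hku' : k ≤ σ.s u := le_trans hku (h.apply_le hE u)
      have hfar := hσ.far k j u hk hjk hj hu hku'
      -- If `u` lies in the growing component, the whole component lies in `D k` and is far from
      -- `j`, so `j` is not near and does not grow.
      by_cases hu0 : u ∈ Comp G ω σ.s σ.n x₀
      · refine h.far_of_notMem_near hE ?_ hfar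
        rintro ⟨-, w, hw, hwf⟩
        refine hwf (hσ.far k j w hk hjk hj (hσ.comp_subset_D hsymm hk hu0 hu hw) ?_)
        rw [s_of_mem_comp hw]; exact hk.le
      · exact h.far_of_notMem hE hω hsymm hle hu0 hfar
    · intro x y hx hy hxy
      change σ.g (f y) + (Φ y - Φ (f y)) + (r + 1) * (nearCount G ω (σ.s ∘ f) σ.n (σ.s (f y)) x : ℝ)
        ≤ (r + 1) * r
      have hfx := h.eq_of_apply_eq hE hx
      by_cases hfy : f y = y
      · have hx' : σ.s x = σ.n := by rw [← hfx]; exact hx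
        have hy' : σ.s y < σ.n := by rw [← hfy]; exact hy
        have := hσ.budget x y hx' hy' hxy
        have h2 : nearCount G ω (σ.s ∘ f) σ.n (σ.s y) x ≤ nearCount G ω σ.s σ.n (σ.s y) x :=
          nearCount_mono fun l _ hl => hnear x hl
        have h3 : (r + 1 : ℝ) * nearCount G ω (σ.s ∘ f) σ.n (σ.s y) x ≤
          (r + 1) * nearCount G ω σ.s σ.n (σ.s y) x := by gcongr
        rw [hfy, sub_self]
        linarith
      · have h1 := hnc y x hfy (hgrown x y hx hfy hxy)
        have h2 := hbud y hfy
        have h3 := hstep y hfy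
        have h4 : (r + 1 : ℝ) * (nearCount G ω (σ.s ∘ f) σ.n (σ.s (f y)) x + 1) ≤
          (r + 1) * nearCount G ω σ.s σ.n (σ.s (f y)) x₀ := by gcongr
        linarith
    · exact fun v hv => add_nonneg (hσ.g_nonneg _ hv) (hwalk v)
    · intro v hv
      change σ.g (f v) + (Φ v - Φ (f v)) ≤ _
      by_cases hfv : f v = v
      · rw [hfv, sub_self, add_zero]
        exact hσ.g_le v (by rw [← hfv]; exact hv)
      · have h1 := hnc v x₀ hfv (self_mem_comp hx₀)
        have h2 := hbud v hfv
        have h3 := hstep v hfv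
        have h5 : (0 : ℝ) ≤ nearCount G ω (σ.s ∘ f) σ.n (σ.s (f v)) x₀ := Nat.cast_nonneg _
        have h4 : (r + 1 : ℝ) * 1 ≤
          (r + 1) * nearCount G ω σ.s σ.n (σ.s (f v)) x₀ := by gcongr; linarith
        linarith
    · exact hσ.lip
    · intro v hv
      have hv' : σ.s (f v) < σ.n := hv
      change |σ.β (f v) - σ.dist (σ.s (f v)) v| ≤ σ.g (f v) + (Φ v - Φ (f v))
      have hw : WalkIn G ω (σ.D (σ.s (f v))) (Φ v - Φ (f v)) v (f v) := (h.walk v).mono fun u hu => by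
        have hu' : f u = f v := hu
        rw [← hu']; exact hmemD u (by rw [hu']; exact hv')
      have h1 := hσ.beta (f v) hv'
      have h2 := hw.lipschitz fun a b ha hb hab => hσ.lip _ a b hv' ha hb hab
      have h3 := (hw.symm hsymm).lipschitz fun a b ha hb hab => hσ.lip _ a b hv' ha hb hab
      rw [abs_le] at h1 ⊢
      constructor <;> linarith [h1.1, h1.2]
    · exact fun v hv => hσ.q_mem (f v) hv
    · exact fun v hv => hσ.label (f v) hv
    · exact hσ.card_X
    · intro v hv
      obtain ⟨L, hL, hw⟩ := hσ.cluster (f v) hv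
      refine ⟨_, ?_, ((h.walk v).mono fun u hu => ?_).trans (hw.mono fun u hu => ?_)⟩
      · change _ ≤ ℓ + (σ.g (f v) + (Φ v - Φ (f v)))
        linarith
      · exact ⟨congrArg σ.s hu, congrArg σ.c hu⟩
      · have hfu : f u = u := hfix u (f v) hv hu.1
        change σ.s (f u) = σ.s (f v) ∧ σ.c (f u) = σ.c (f v)
        rw [hfu]; exact hu
  · constructor
    · intro v hv
      have hv' : σ.s (f v) = σ.n := hv
      rw [h.eq_of_apply_eq hE hv'] at hv'
      exact hv'
    · intro hsub
      obtain ⟨v, hv, hfv⟩ := h.exists_moved hE hω hle hi hi'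
      have := hsub hv
      change σ.s (f v) = σ.n at this
      omega

end CopState

/-! ### Skeletons and the creation of supernodes. -/

/-- A shortest-path tree `T` from `ρ` to the vertices of `X` inside the connected set `H`, cut
along the branches into bands of length `ℓ`. -/
theorem exists_skeleton {V : Type*} [Finite V] {G : SimpleGraph V} {ω : V → V → ℝ}
    (hω : ∀ u v, G.Adj u v → 0 < ω u v) {ℓ : ℝ} (hℓ : 0 < ℓ) {H : Set V} {ρ : V}
    (hH : ∀ u ∈ H, ∃ L, WalkIn G ω H L u ρ) {X : Finset V} (hX : ∀ x ∈ X, x ∈ H) :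
    ∃ (T : Set V) (Φ : V → ℝ) (c q : V → V) (lab : V → ℤ → V), T ⊆ H ∧ (∀ x ∈ X, x ∈ T) ∧
      (∀ u v, u ∈ H → v ∈ H → G.Adj u v → Φ u ≤ Φ v + ω u v) ∧
      (∀ v ∈ T, ∃ L, WalkIn G ω T L v ρ) ∧
      ∀ v ∈ T, q v ∈ X ∧ c v = lab (q v) ⌊Φ v / ℓ⌋ ∧
        ∃ L ≤ ℓ, WalkIn G ω {u | u ∈ T ∧ c u = c v} L v (c v) := by
  classical
  choose! len hlen using hH
  obtain ⟨M₀, hM₀⟩ := (Set.finite_range len).bddAbove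
  have hM : ∀ u, len u < max M₀ 0 + 1 := fun u => by
    have := hM₀ ⟨u, rfl⟩
    have := le_max_left M₀ 0
    linarith
  -- The cap exceeds the length of some walk in `H` to `ρ`, so at every other vertex of `H` the
  -- potential is attained through an edge of `H`.
  obtain ⟨Φ, hφ, hlip, htight, -⟩ := exists_potential (fun u v => G.Adj u v ∧ u ∈ H ∧ v ∈ H) ω
    (fun u v h => (hω u v h.1).le) (fun v => if v = ρ then 0 else max M₀ 0 + 1)
  have hΦρ : Φ ρ ≤ 0 := by simpa using hφ ρ
  let N : Set V := {v | v ∈ H ∧ v ≠ ρ}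
  have hpar : ∀ v, ∃ p, v ∈ N → G.Adj v p ∧ p ∈ H ∧ Φ v = Φ p + ω v p := fun v => by
    by_cases hv : v ∈ N
    · rcases htight v with h | ⟨p, ⟨hp, -, hpH⟩, h⟩
      · rw [if_neg hv.2] at h
        have h1 : Φ v ≤ Φ ρ + len v :=
          (hlen v hv.1).lipschitz fun a b ha hb hab => hlip a b ⟨hab, ha, hb⟩
        have := hM v
        linarith
      · exact ⟨p, fun _ => ⟨hp, hpH, h⟩⟩
    · exact ⟨v, fun h => absurd h hv⟩
  choose par hpar using hpar
  have hlt : ∀ v ∈ N, Φ (par v) < Φ v := fun v hv => by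
    have := hpar v hv
    have := hω _ _ this.1
    linarith
  let Anc : V → V → Prop := Relation.ReflTransGen fun a b => a ∈ N ∧ b = par a
  have hAncH : ∀ x u, Anc x u → x ∈ H → u ∈ H := fun x u h hx => by
    induction h with
    | refl => exact hx
    | tail _ h _ => rw [h.2]; exact (hpar _ h.1).2.1
  have hAncΦ : ∀ x u, Anc x u → Φ u ≤ Φ x := fun x u h => by
    induction h with
    | refl => exact le_rfl
    | tail _ h ih => rw [h.2]; exact (hlt _ h.1).le.trans ih
  let T : Set V := {u | ∃ x ∈ X, Anc x u}
  have hTH : T ⊆ H := fun u ⟨x, hx, h⟩ => hAncH x u h (hX x hx)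
  have hTpar : ∀ u ∈ T, u ∈ N → par u ∈ T := fun u ⟨x, hx, h⟩ hu => ⟨x, hx, h.tail ⟨hu, rfl⟩⟩
  let band : V → ℤ := fun v => ⌊Φ v / ℓ⌋
  have hband : ∀ u v, Φ u ≤ Φ v → band u ≤ band v := fun u v h =>
    Int.floor_le_floor (by gcongr)
  -- Pointers are followed only within one band; the vertex `top` where they stop is the cluster
  -- center.
  let N₁ : Set V := {t | t ∈ T ∧ t ∈ N ∧ band (par t) = band t}
  have hlt₁ : ∀ v ∈ N₁, Φ (par v) < Φ v := fun v hv => hlt v hv.2.1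
  obtain ⟨top, h0, h1, -⟩ := exists_root hlt₁
  have htop : ∀ v, v ∈ T → WalkIn G ω {u | u ∈ T ∧ top u = top v} (Φ v - Φ (top v)) v (top v) ∧
      band (top v) = band v := fun v => by
    induction v using descent_induction hlt₁ with
    | h0 v hv =>
      intro hvT
      have := h0 v hv
      rw [this, sub_self]
      exact ⟨WalkIn.nil ⟨hvT, this⟩, rfl⟩
    | h1 v hv ih =>
      intro hvT
      obtain ⟨w, hb⟩ := ih (hTpar v hv.1 hv.2.1)
      rw [h1 v hv, (hpar v hv.2.1).2.2, show Φ (par v) + ω v (par v) - Φ (top (par v)) =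
        ω v (par v) + (Φ (par v) - Φ (top (par v))) by ring]
      exact ⟨WalkIn.cons ⟨hvT, h1 v hv⟩ (hpar v hv.2.1).1 w, hb.trans hv.2.2⟩
  have hchain : ∀ u v, Anc u v → u ∈ T → band u = band v → top u = top v := fun u v h => by
    induction h using Relation.ReflTransGen.head_induction_on with
    | refl => exact fun _ _ => rfl
    | @head a b hab hbv ih =>
      intro haT hb
      obtain ⟨haN, rfl⟩ := hab
      have e1 := hband _ _ (hlt a haN).le
      have e2 := hband _ _ (hAncΦ _ _ hbv)
      have e3 : band (par a) = band a := by omega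
      rw [h1 a ⟨haT, haN, e3⟩]
      exact ih (hTpar a haT haN) (e3.trans hb)
  -- The ancestors of `x` form a chain along which the bands are monotone, so one branch and one
  -- band determine a single cluster.
  have huniq : ∀ x ∈ X, ∀ u v, Anc x u → Anc x v → band u = band v → top u = top v :=
    fun x hx u v hu hv huv => by
      have hru : Relator.RightUnique fun a b => a ∈ N ∧ b = par a :=
        fun a b c hb hc => hb.2.trans hc.2.symm
      rcases Relation.ReflTransGen.total_of_right_unique hru hu hv with h | h
      · exact hchain u v h ⟨x, hx, hu⟩ huv
      · exact (hchain v u h ⟨x, hx, hv⟩ huv.symm).symm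
  have hq : ∀ v, ∃ x, v ∈ T → x ∈ X ∧ Anc x v := fun v => by
    by_cases hv : v ∈ T
    · obtain ⟨x, hx, h⟩ := hv
      exact ⟨x, fun _ => ⟨hx, h⟩⟩
    · exact ⟨v, fun h => absurd h hv⟩
  choose q hq using hq
  let lab : V → ℤ → V := fun x b =>
    if h : ∃ u, Anc x u ∧ band u = b then top h.choose else x
  refine ⟨T, Φ, top, q, lab, hTH, fun x hx => ⟨x, hx, Relation.ReflTransGen.refl⟩,
    fun u v hu hv huv => hlip u v ⟨huv, hu, hv⟩, fun v => ?_, fun v hv => ⟨(hq v hv).1, ?_, ?_⟩⟩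
  · induction v using descent_induction hlt with
    | h0 v hv =>
      intro hvT
      have : v = ρ := by_contra fun hne => hv ⟨hTH hvT, hne⟩
      subst this
      exact ⟨0, WalkIn.nil hvT⟩
    | h1 v hv ih =>
      intro hvT
      obtain ⟨L, w⟩ := ih (hTpar v hvT hv)
      exact ⟨_, WalkIn.cons hvT (hpar v hv).1 w⟩
  · have hex : ∃ u, Anc (q v) u ∧ band u = ⌊Φ v / ℓ⌋ := ⟨v, (hq v hv).2, rfl⟩
    simp only [lab, dif_pos hex]
    exact huniq _ (hq v hv).1 _ _ (hq v hv).2 hex.choose_spec.1 hex.choose_spec.2.symm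
  · obtain ⟨w, hb⟩ := htop v hv
    refine ⟨_, ?_, w⟩
    have h2 := Int.abs_sub_lt_one_of_floor_eq_floor hb.symm
    rw [abs_lt, ← sub_div, div_lt_one hℓ] at h2
    exact h2.2.le

namespace CopState

variable {V : Type*} {G : SimpleGraph V} {ω : V → V → ℝ}

/-- By `hdef` the near supernodes are all adjacent, hence fewer than `r`. The skeleton of the new
supernode touches every adjacent supernode, which preserves `clique`, and its budget starts with no
growth and at most `r` near older supernodes. -/
theorem Valid.exists_create [Finite V] {r : ℕ} {ℓ : ℝ} (hℓ : 0 < ℓ) {σ : CopState V}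
    (hσ : σ.Valid G ω r ℓ)
    (hω : ∀ u v, G.Adj u v → 0 < ω u v) (hsymm : ∀ u v, ω u v = ω v u)
    (hG : CliqueMinorFree r G) {x₀ : V} (hx₀ : σ.s x₀ = σ.n)
    (hdef : ∀ i ∈ Near G ω σ.s σ.n x₀, ∃ u ∈ Comp G ω σ.s σ.n x₀, ∃ y, G.Adj u y ∧ σ.s y = i) :
    ∃ τ : CopState V, τ.Valid G ω r ℓ ∧ {v | τ.s v = τ.n} ⊂ {v | σ.s v = σ.n} := by
  classical
  let F : Finset ℕ := (Finset.range σ.n).filter fun k =>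
    ∃ u ∈ Comp G ω σ.s σ.n x₀, ∃ y, G.Adj u y ∧ σ.s y = k
  have hFmem : ∀ k, k ∈ F ↔ k < σ.n ∧ ∃ u ∈ Comp G ω σ.s σ.n x₀, ∃ y, G.Adj u y ∧ σ.s y = k :=
    fun k => by simp [F]
  have hFr : F.card + 1 < r := hσ.card_adjacent_lt hsymm hG hx₀ F fun k hk => (hFmem k).1 hk
  let A : Finset ℕ := F.filter fun k => k ∈ Near G ω σ.s σ.n x₀
  have hA : ∀ k, k ∈ A ↔ k ∈ Near G ω σ.s σ.n x₀ := fun k => by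
    simp only [A, Finset.mem_filter, hFmem]
    exact ⟨fun h => h.2, fun h => ⟨⟨h.1, hdef k h⟩, h⟩⟩
  have hAr : A.card + 1 < r := by
    have : A.card ≤ F.card := Finset.card_filter_le _ _
    omega
  have htgt : ∀ k, ∃ u, k ∈ F → u ∈ Comp G ω σ.s σ.n x₀ ∧ ∃ y, G.Adj u y ∧ σ.s y = k := fun k => by
    by_cases hk : k ∈ F
    · obtain ⟨u, hu, h⟩ := ((hFmem k).1 hk).2
      exact ⟨u, fun _ => ⟨hu, h⟩⟩
    · exact ⟨x₀, fun h => absurd h hk⟩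
  choose tgt htgt using htgt
  -- One contact vertex for each adjacent supernode, and the root, so that the skeleton is nonempty.
  let X : Finset V := insert x₀ (F.image tgt)
  have hXr : X.card ≤ r := by
    have h1 : X.card ≤ (F.image tgt).card + 1 := Finset.card_insert_le _ _
    have h2 : (F.image tgt).card ≤ F.card := Finset.card_image_le
    omega
  have hXH : ∀ x ∈ X, x ∈ Comp G ω σ.s σ.n x₀ := fun x hx => by
    simp only [X, Finset.mem_insert, Finset.mem_image] at hx
    rcases hx with rfl | ⟨k, hk, rfl⟩
    · exact self_mem_comp hx₀
    · exact (htgt k hk).1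
  obtain ⟨T, Φ, c, q, lab, hTH, hXT, hlip, hroot, hT⟩ := exists_skeleton hω hℓ
    (H := Comp G ω σ.s σ.n x₀) (ρ := x₀) (fun u ⟨L, hu⟩ =>
      ⟨L, (walkIn_comp hu (self_mem_comp hx₀)).symm hsymm⟩) hXH
  have hTn : ∀ v ∈ T, σ.s v = σ.n := fun v hv => s_of_mem_comp (hTH hv)
  -- The number `σ.n` now names the new supernode, and `σ.n + 1` becomes the mark of unassigned
  -- vertices.
  let s' : V → ℕ := fun v => if v ∈ T then σ.n else if σ.s v = σ.n then σ.n + 1 else σ.s v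
  have hle := hσ.le_n
  have hs'T : ∀ v ∈ T, s' v = σ.n := fun v hv => if_pos hv
  have hs'old : ∀ v, σ.s v < σ.n → s' v = σ.s v := fun v hv => by
    have : v ∉ T := fun h => by have := hTn v h; omega
    simp only [s', if_neg this, if_neg hv.ne]
  have hs'eq : ∀ v j, j < σ.n → (s' v = j ↔ σ.s v = j) := fun v j hj => by
    simp only [s']
    split_ifs with h1 h2
    · have := hTn v h1; omega
    · omega
    · rfl
  have hs'ge : ∀ v j, j ≤ σ.n → (j ≤ s' v ↔ j ≤ σ.s v) := fun v j hj => by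
    simp only [s']
    split_ifs with h1 h2
    · have := hTn v h1; omega
    · omega
    · rfl
  have hs'top : ∀ v, s' v = σ.n + 1 → σ.s v = σ.n ∧ v ∉ T := fun v => by
    simp only [s']
    split_ifs with h1 h2
    · omega
    · exact fun _ => ⟨h2, h1⟩
    · have := hle v; omega
  have hcases : ∀ v, s' v < σ.n + 1 → v ∈ T ∨ (v ∉ T ∧ σ.s v < σ.n ∧ s' v = σ.s v) := fun v => by
    simp only [s']
    split_ifs with h1 h2
    · exact fun _ => Or.inl h1
    · omega
    · exact fun _ => Or.inr ⟨h1, lt_of_le_of_ne (hle v) h2, rfl⟩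
  have hfar : ∀ j u, j < σ.n → (Far G ω s' j u ↔ Far G ω σ.s j u) := fun j u hj => by
    unfold Far
    have : {v | j ≤ s' v} = {v | j ≤ σ.s v} := by
      ext v; exact hs'ge v j hj.le
    rw [this]
    simp only [hs'eq _ j hj]
  have hcomp : ∀ x, Comp G ω s' (σ.n + 1) x ⊆ Comp G ω σ.s σ.n x := fun x u ⟨L, hw⟩ =>
    ⟨L, hw.mono fun v hv => (hs'top v hv).1⟩
  have hnear : ∀ x l, l < σ.n → l ∈ Near G ω s' (σ.n + 1) x → l ∈ Near G ω σ.s σ.n x :=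
    fun x l hl ⟨_, u, hu, huf⟩ => ⟨hl, u, hcomp x hu, fun h => huf ((hfar l u hl).2 h)⟩
  let τ : CopState V :=
    { n := σ.n + 1
      s := s'
      D := Function.update σ.D σ.n (Comp G ω σ.s σ.n x₀)
      A := Function.update σ.A σ.n A
      X := Function.update σ.X σ.n X
      dist := Function.update σ.dist σ.n Φ
      root := Function.update σ.root σ.n x₀
      lab := Function.update σ.lab σ.n lab
      g := fun v => if v ∈ T then 0 else σ.g v
      β := fun v => if v ∈ T then Φ v else σ.β v
      q := fun v => if v ∈ T then q v else σ.q v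
      c := fun v => if v ∈ T then c v else σ.c v }
  refine ⟨τ, ?_, ?_⟩
  · constructor
    · intro v
      simp only [τ, s']
      have := hle v
      split_ifs <;> omega
    · intro v hv
      rcases hcases v hv with h | ⟨h, h1, h2⟩
      · simpa [τ, hs'T v h] using hTH h
      · simpa [τ, h2, h1.ne] using hσ.mem_D v h1
    · intro i u v hi hu huv hv
      simp only [τ] at hi hu hv ⊢
      by_cases hin : i = σ.n
      · subst hin
        simp only [Function.update_self] at hu ⊢
        exact comp_closed hu huv (le_antisymm (hle v) ((hs'ge v σ.n le_rfl).1 hv))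
      · rw [Function.update_of_ne hin] at hu ⊢
        exact hσ.D_closed i u v (by omega) hu huv ((hs'ge v i (by omega)).1 hv)
    · intro v hv
      rcases hcases v hv with h | ⟨h, h1, h2⟩
      · obtain ⟨L, hw⟩ := hroot v h
        refine ⟨L, ?_⟩
        simp only [τ, hs'T v h, Function.update_self]
        exact hw.mono fun u hu => hs'T u hu
      · obtain ⟨L, hw⟩ := hσ.conn v h1
        refine ⟨L, ?_⟩
        simp only [τ, h2, Function.update_of_ne h1.ne]
        exact hw.mono fun u hu => (hs'eq u _ h1).2 hu
    · intro x x' y y' hx hx' hxy hxy' hy hy' hne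
      have hx1 := hs'top x hx
      have hxx' := hcomp x hx'
      -- adjacency of the new supernode
      have hnew : ∀ x y x' y', s' x = σ.n + 1 → x' ∈ Comp G ω σ.s σ.n x → G.Adj x y →
          G.Adj x' y' → y ∈ T → σ.s y' < σ.n → ∃ a b, a ∈ T ∧ σ.s b = σ.s y' ∧ G.Adj a b := by
        intro x y x' y' hx hx' hxy hxy' hy hy'
        have hx0 : x ∈ Comp G ω σ.s σ.n x₀ := comp_closed (hTH hy) hxy.symm (hs'top x hx).1
        rw [comp_eq hsymm hx0] at hx'
        have hF : σ.s y' ∈ F := (hFmem _).2 ⟨hy', x', hx', y', hxy', rfl⟩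
        obtain ⟨-, b, hab, hb⟩ := htgt _ hF
        exact ⟨_, b, hXT _ (Finset.mem_insert_of_mem (Finset.mem_image_of_mem _ hF)), hb, hab⟩
      rcases hcases y hy with h | ⟨h, h1, h2⟩ <;> rcases hcases y' hy' with h' | ⟨h', h1', h2'⟩
      · exact absurd ((hs'T y h).trans (hs'T y' h').symm) hne
      · obtain ⟨a, b, ha, hb, hab⟩ := hnew x y x' y' hx hxx' hxy hxy' h h1'
        exact ⟨a, b, (hs'T a ha).trans (hs'T y h).symm,
          ((hs'eq b _ h1').2 hb).trans h2'.symm, hab⟩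
      · obtain ⟨a, b, ha, hb, hab⟩ := hnew x' y' x y (s_of_mem_comp (s := s') hx')
          (by rw [comp_eq hsymm hxx']; exact self_mem_comp hx1.1) hxy' hxy h' h1
        exact ⟨b, a, ((hs'eq b _ h1).2 hb).trans h2.symm,
          (hs'T a ha).trans (hs'T y' h').symm, hab.symm⟩
      · obtain ⟨a, b, ha, hb, hab⟩ := hσ.clique x x' y y' hx1.1 hxx' hxy hxy' h1 h1'
          (by rwa [← h2, ← h2'])
        exact ⟨a, b, ((hs'eq a _ h1).2 ha).trans h2.symm, ((hs'eq b _ h1').2 hb).trans h2'.symm,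
          hab⟩
    · intro i hi
      simp only [τ] at hi ⊢
      by_cases hin : i = σ.n
      · subst hin; rw [Function.update_self]; omega
      · rw [Function.update_of_ne hin]; exact hσ.card_A i (by omega)
    · intro i j u hi hj hjA hu hiu
      simp only [τ] at hi hj hjA hu hiu ⊢
      rw [hfar j u (by omega)]
      by_cases hin : i = σ.n
      · subst hin
        rw [Function.update_self] at hjA hu
        rw [hA] at hjA
        exact by_contra fun hc => hjA ⟨hj, u, hu, hc⟩
      · rw [Function.update_of_ne hin] at hjA hu
        exact hσ.far i j u (by omega) hj hjA hu ((hs'ge u i (by omega)).1 hiu)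
    · intro x y hx hy hxy
      have hx1 := hs'top x hx
      change (if y ∈ T then 0 else σ.g y) +
        (r + 1 : ℝ) * (nearCount G ω s' (σ.n + 1) (s' y) x : ℝ) ≤ (r + 1) * r
      rcases hcases y hy with h | ⟨h, h1, h2⟩
      · rw [if_pos h, hs'T y h, zero_add]
        have hx0 : x ∈ Comp G ω σ.s σ.n x₀ := comp_closed (hTH h) hxy.symm hx1.1
        have : nearCount G ω s' (σ.n + 1) σ.n x ≤ r := by
          refine le_trans ?_ (show A.card ≤ r by omega)
          rw [← Set.ncard_coe_finset A]
          refine Set.ncard_le_ncard (fun l hl => ?_) (Finset.finite_toSet _)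
          have := hnear x l hl.1 hl.2
          rw [near_eq hsymm hx0] at this
          exact (hA l).2 this
        have : (nearCount G ω s' (σ.n + 1) σ.n x : ℝ) ≤ r := by exact_mod_cast this
        gcongr
      · rw [if_neg h, h2]
        have h3 := hσ.budget x y hx1.1 h1 hxy
        have h4 : nearCount G ω s' (σ.n + 1) (σ.s y) x ≤ nearCount G ω σ.s σ.n (σ.s y) x :=
          nearCount_mono fun l hl hl' => hnear x l (by omega) hl'
        have h5 : (r + 1 : ℝ) * nearCount G ω s' (σ.n + 1) (σ.s y) x ≤
          (r + 1) * nearCount G ω σ.s σ.n (σ.s y) x := by gcongr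
        linarith
    · intro v hv
      rcases hcases v hv with h | ⟨h, h1, h2⟩
      · simp [τ, h]
      · simpa [τ, h] using hσ.g_nonneg v h1
    · intro v hv
      rcases hcases v hv with h | ⟨h, h1, h2⟩
      · simp only [τ, h, if_true]; positivity
      · simpa [τ, h] using hσ.g_le v h1
    · intro i u v hi hu hv huv
      simp only [τ] at hi hu hv ⊢
      by_cases hin : i = σ.n
      · subst hin
        rw [Function.update_self] at hu hv ⊢
        exact hlip u v hu hv huv
      · rw [Function.update_of_ne hin] at hu hv ⊢
        exact hσ.lip i u v (by omega) hu hv huv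
    · intro v hv
      rcases hcases v hv with h | ⟨h, h1, h2⟩
      · simp [τ, h, hs'T v h]
      · simpa [τ, h, h2, h1.ne] using hσ.beta v h1
    · intro v hv
      rcases hcases v hv with h | ⟨h, h1, h2⟩
      · simpa only [τ, h, if_true, hs'T v h, Function.update_self] using (hT v h).1
      · simpa only [τ, h, if_false, h2, Function.update_of_ne h1.ne] using hσ.q_mem v h1
    · intro v hv
      rcases hcases v hv with h | ⟨h, h1, h2⟩
      · simpa only [τ, h, if_true, hs'T v h, Function.update_self] using (hT v h).2.1
      · simpa only [τ, h, if_false, h2, Function.update_of_ne h1.ne] using hσ.label v h1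
    · intro i hi
      simp only [τ] at hi ⊢
      by_cases hin : i = σ.n
      · subst hin; rwa [Function.update_self]
      · rw [Function.update_of_ne hin]; exact hσ.card_X i (by omega)
    · intro v hv
      rcases hcases v hv with h | ⟨h, h1, h2⟩
      · obtain ⟨L, hL, hw⟩ := (hT v h).2.2
        refine ⟨L, by simpa [τ, h] using hL, ?_⟩
        simp only [τ, h, if_true]
        refine hw.mono fun u hu => ?_
        refine ⟨(hs'T u hu.1).trans (hs'T v h).symm, ?_⟩
        rw [if_pos hu.1]; exact hu.2
      · obtain ⟨L, hL, hw⟩ := hσ.cluster v h1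
        refine ⟨L, by simpa [τ, h] using hL, ?_⟩
        simp only [τ, h, if_false]
        refine hw.mono fun u hu => ?_
        have hu1 : σ.s u = σ.s v := hu.1
        have huT : u ∉ T := fun hc => by have := hTn u hc; omega
        refine ⟨by rw [hs'old u (by omega), h2, hu1], ?_⟩
        rw [if_neg huT]; exact hu.2
  · constructor
    · exact fun v hv => (hs'top v hv).1
    · intro hsub
      have hx0T : x₀ ∈ T := hXT _ (Finset.mem_insert_self _ _)
      have := hsub hx₀
      change s' x₀ = σ.n + 1 at this
      rw [hs'T x₀ hx0T] at this
      omega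

/-- Growing and creating both shrink the unassigned set. The initial state has no supernodes, so its
invariants are vacuous. -/
theorem exists_valid [Finite V] [Nonempty V] {r : ℕ} {ℓ : ℝ} (hℓ : 0 < ℓ)
    (hω : ∀ u v, G.Adj u v → 0 < ω u v) (hsymm : ∀ u v, ω u v = ω v u)
    (hG : CliqueMinorFree r G) : ∃ σ : CopState V, σ.Valid G ω r ℓ ∧ ∀ v, σ.s v < σ.n := by
  suffices h : ∀ m, ∀ σ : CopState V, σ.Valid G ω r ℓ → {v | σ.s v = σ.n}.ncard ≤ m →
      ∃ σ : CopState V, σ.Valid G ω r ℓ ∧ ∀ v, σ.s v < σ.n by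
    obtain ⟨v₀⟩ := ‹Nonempty V›
    let σ₀ : CopState V := ⟨0, fun _ => 0, fun _ => ∅, fun _ => ∅, fun _ => ∅, fun _ _ => 0,
      fun _ => v₀, fun _ _ _ => v₀, fun _ => 0, fun _ => 0, id, id⟩
    refine h _ σ₀ ?_ le_rfl
    constructor <;> simp [σ₀]
  intro m
  induction m with
  | zero =>
    intro σ hσ hm
    refine ⟨σ, hσ, fun v => lt_of_le_of_ne (hσ.le_n v) fun hv => ?_⟩
    rw [Nat.le_zero, Set.ncard_eq_zero] at hm
    exact Set.notMem_empty v (hm ▸ hv)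
  | succ m ih =>
    intro σ hσ hm
    by_cases hall : ∀ v, σ.s v < σ.n
    · exact ⟨σ, hσ, hall⟩
    push Not at hall
    obtain ⟨x₀, hx₀⟩ := hall
    have hx₀ : σ.s x₀ = σ.n := le_antisymm (hσ.le_n x₀) hx₀
    obtain ⟨τ, hτ, hlt⟩ : ∃ τ : CopState V, τ.Valid G ω r ℓ ∧
        {v | τ.s v = τ.n} ⊂ {v | σ.s v = σ.n} := by
      by_cases hdef : ∀ i ∈ Near G ω σ.s σ.n x₀,
          ∃ u ∈ Comp G ω σ.s σ.n x₀, ∃ y, G.Adj u y ∧ σ.s y = i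
      · exact hσ.exists_create hℓ hω hsymm hG hx₀ hdef
      · push Not at hdef
        obtain ⟨i, hi', hi⟩ := hdef
        exact hσ.exists_grow hω hsymm hG hx₀ hi' hi
    have := Set.ncard_lt_ncard hlt
    exact ih τ hτ (by omega)

end CopState

/-! ### From the cop decomposition to clusters. -/

/-- A buffered cop decomposition together with a partition of its supernodes into clusters: `s v`
is the supernode of `v`, the set `A i` has fewer than `r` elements and contains the supernodes
that are older than `i` and close to `i`, and `c v` is the center of the cluster of `v`. -/
structure IsDecomposition {V : Type*} (G : SimpleGraph V) (ω : V → V → ℝ) (r : ℕ) (ρ : ℝ)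
    (s : V → ℕ) (A : ℕ → Finset ℕ) (c : V → V) : Prop where
  card_A : ∀ v, (A (s v)).card < r
  near : ∀ u z L, WalkIn G ω {v | s z ≤ s v} L u z → s z < s u → L < 1 → s z ∈ A (s u)
  hits : ∀ (i : ℕ) (P : Set V), (∀ v ∈ P, s v = i) →
    (∀ u ∈ P, ∀ v ∈ P, ∃ L < 1, WalkIn G ω {w | i ≤ s w} L u v) → (c '' P).ncard ≤ 2 * r
  cluster : ∀ v, ∃ L ≤ ρ, WalkIn G ω {u | c u = c v} L v (c v)
  s_eq : ∀ v, s (c v) = s v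

theorem exists_isDecomposition {V : Type*} [Finite V] [Nonempty V] {G : SimpleGraph V}
    {ω : V → V → ℝ} {r : ℕ} (hω : ∀ u v, G.Adj u v → 0 < ω u v) (hsymm : ∀ u v, ω u v = ω v u)
    (hG : CliqueMinorFree r G) :
    ∃ s A c, IsDecomposition G ω r (3 * ((r + 1) * r) + 1) s A c := by
  -- Attachment levels `β` differ from true distances by at most `(r + 1) * r`. With this `ℓ`,
  -- vertices at distance below one have levels less than one band length apart. The cluster radius
  -- is `ℓ + (r + 1) * r`.
  obtain ⟨σ, hσ, hall⟩ := CopState.exists_valid (ℓ := 2 * ((r + 1) * r) + 1) (by positivity)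
    hω hsymm hG
  refine ⟨σ.s, σ.A, σ.c, fun v => hσ.card_A _ (hall v), ?_, ?_, ?_, ?_⟩
  · intro u z L hw hzu hL
    by_contra hA
    exact absurd (hσ.far (σ.s u) (σ.s z) u (hall u) hzu hA (hσ.mem_D u (hall u)) le_rfl L z hw rfl)
      (not_le.2 hL)
  · intro i P hP hPP
    classical
    rcases P.eq_empty_or_nonempty with rfl | hne
    · simp
    set ℓ : ℝ := 2 * ((r + 1) * r) + 1 with hℓ
    have hℓ0 : 0 < ℓ := by positivity
    obtain ⟨v₀, hv₀, hmin⟩ := Set.exists_min_image P (fun v => ⌊σ.β v / ℓ⌋) (Set.toFinite P) hne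
    have hi : i < σ.n := hP v₀ hv₀ ▸ hall v₀
    -- At most `r` branches and two consecutive bands, starting from the lowest one met.
    have hsub : σ.c '' P ⊆ (fun p : V × ℤ => σ.lab i p.1 p.2) ''
        ((σ.X i ×ˢ ({⌊σ.β v₀ / ℓ⌋, ⌊σ.β v₀ / ℓ⌋ + 1} : Finset ℤ) : Finset (V × ℤ)) :
          Set (V × ℤ)) := by
      rintro _ ⟨v, hv, rfl⟩
      refine ⟨(σ.q v, ⌊σ.β v / ℓ⌋), ?_, ?_⟩
      · have hq := hσ.q_mem v (hall v)
        rw [hP v hv] at hq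
        have h1 := hmin v hv
        obtain ⟨L, hL, hw⟩ := hPP v hv v₀ hv₀
        have hw' : WalkIn G ω (σ.D i) L v v₀ := (hw.refine_set (T := σ.D i)
          (hP v hv ▸ hσ.mem_D v (hall v)) fun a b ha _ hb hab =>
            hσ.D_closed i a b hi ha hab hb).mono Set.inter_subset_right
        have h2 := hw'.lipschitz fun a b ha hb hab => hσ.lip i a b hi ha hb hab
        have h3 := hσ.beta v (hall v)
        have h4 := hσ.beta v₀ (hall v₀)
        have h5 := hσ.g_le v (hall v)
        have h6 := hσ.g_le v₀ (hall v₀)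
        rw [hP v hv, abs_le] at h3
        rw [hP v₀ hv₀, abs_le] at h4
        have h7 : σ.β v / ℓ < σ.β v₀ / ℓ + 1 := by
          rw [div_add_one hℓ0.ne', div_lt_div_iff_of_pos_right hℓ0]
          linarith [h3.1, h3.2, h4.1, h4.2]
        have h8 : ⌊σ.β v / ℓ⌋ ≤ ⌊σ.β v₀ / ℓ⌋ + 1 := by
          rw [← Int.floor_add_one]; exact Int.floor_le_floor h7.le
        have h9 : ⌊σ.β v / ℓ⌋ = ⌊σ.β v₀ / ℓ⌋ ∨ ⌊σ.β v / ℓ⌋ = ⌊σ.β v₀ / ℓ⌋ + 1 := by omega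
        simpa using ⟨hq, h9⟩
      · have := hσ.label v (hall v)
        rw [hP v hv] at this
        exact this.symm
    calc (σ.c '' P).ncard ≤ _ := Set.ncard_le_ncard hsub (Set.toFinite _)
      _ ≤ _ := Set.ncard_image_le (Finset.finite_toSet _)
      _ = (σ.X i ×ˢ ({⌊σ.β v₀ / ℓ⌋, ⌊σ.β v₀ / ℓ⌋ + 1} : Finset ℤ)).card := Set.ncard_coe_finset _
      _ ≤ r * 2 := by
        rw [Finset.card_product]
        exact Nat.mul_le_mul (hσ.card_X i hi) Finset.card_le_two
      _ = 2 * r := mul_comm _ _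
  · intro v
    obtain ⟨L, hL, hw⟩ := hσ.cluster v (hall v)
    have := hσ.g_le v (hall v)
    exact ⟨L, by linarith, hw.mono fun u hu => hu.2⟩
  · intro v
    obtain ⟨L, hL, hw⟩ := hσ.cluster v (hall v)
    exact hw.right_mem.1

/-! ### Vertex lists and the recursive shortcut. -/

/-- The length of a walk that is given by the list of its vertices. -/
def listLength {V : Type*} (ω : V → V → ℝ) : List V → ℝ
  | [] => 0
  | [_] => 0
  | a :: b :: l => ω a b + listLength ω (b :: l)

section

variable {V : Type*} {G : SimpleGraph V} {ω : V → V → ℝ}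

theorem listLength_nonneg (hω : ∀ u v, G.Adj u v → 0 < ω u v) (l : List V)
    (h : l.IsChain G.Adj) : 0 ≤ listLength ω l := by
  induction l with
  | nil => exact le_rfl
  | cons a l ih =>
    cases l with
    | nil => exact le_rfl
    | cons b l =>
      rw [List.isChain_cons_cons] at h
      exact add_nonneg (hω _ _ h.1).le (ih h.2)

theorem listLength_le_append_left (hω : ∀ u v, G.Adj u v → 0 < ω u v) (l₁ l₂ : List V)
    (h : (l₁ ++ l₂).IsChain G.Adj) : listLength ω l₂ ≤ listLength ω (l₁ ++ l₂) := by
  induction l₁ with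
  | nil => exact le_rfl
  | cons a l ih =>
    have h' : (l ++ l₂).IsChain G.Adj := h.tail
    refine (ih h').trans ?_
    rw [List.cons_append] at h ⊢
    cases hl : l ++ l₂ with
    | nil => exact le_rfl
    | cons b m =>
      rw [hl, List.isChain_cons_cons] at h
      have := hω _ _ h.1
      simp only [listLength]
      linarith

theorem listLength_le_append_right (hω : ∀ u v, G.Adj u v → 0 < ω u v) (l₁ l₂ : List V)
    (h : (l₁ ++ l₂).IsChain G.Adj) : listLength ω l₁ ≤ listLength ω (l₁ ++ l₂) := by
  induction l₁ with
  | nil => exact listLength_nonneg hω _ h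
  | cons a l ih =>
    have h' : (l ++ l₂).IsChain G.Adj := h.tail
    cases l with
    | nil => exact listLength_nonneg hω _ h
    | cons b m => exact add_le_add_right (ih h') _

theorem listLength_le_of_infix (hω : ∀ u v, G.Adj u v → 0 < ω u v) {l₁ l₂ : List V}
    (hl : l₁ <:+: l₂) (h : l₂.IsChain G.Adj) : listLength ω l₁ ≤ listLength ω l₂ := by
  obtain ⟨a, b, rfl⟩ := hl
  have h' : (a ++ l₁).IsChain G.Adj := h.left_of_append
  exact (listLength_le_append_left hω a l₁ h').trans (listLength_le_append_right hω _ b h)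

theorem exists_walkIn_of_list (hω : ∀ u v, G.Adj u v → 0 < ω u v) (hsymm : ∀ u v, ω u v = ω v u)
    {S : Set V} (l : List V) (h : l.IsChain G.Adj) (hS : ∀ x ∈ l, x ∈ S) :
    ∀ a ∈ l, ∀ b ∈ l, ∃ L ≤ listLength ω l, WalkIn G ω S L a b := by
  induction l with
  | nil => simp
  | cons x l ih =>
    cases l with
    | nil =>
      intro a ha b hb
      simp only [List.mem_singleton] at ha hb
      subst ha hb
      exact ⟨0, le_rfl, WalkIn.nil (hS _ (by simp))⟩
    | cons y l =>
      rw [List.isChain_cons_cons] at h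
      have ih := ih h.2 fun z hz => hS z (List.mem_cons_of_mem _ hz)
      have hx := hS x (by simp)
      have hxy := hω _ _ h.1
      have hl := listLength_nonneg hω _ h.2
      have hxb : ∀ b ∈ y :: l, ∃ L ≤ listLength ω (x :: y :: l), WalkIn G ω S L x b :=
        fun b hb => by
          obtain ⟨L, hL, w⟩ := ih y (by simp) b hb
          exact ⟨_, by simp only [listLength]; linarith, WalkIn.cons hx h.1 w⟩
      intro a ha b hb
      rcases List.mem_cons.1 ha with ha' | ha' <;> rcases List.mem_cons.1 hb with hb' | hb'
      · subst ha' hb'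
        exact ⟨0, by simp only [listLength]; linarith, WalkIn.nil hx⟩
      · subst ha'
        exact hxb b hb'
      · subst hb'
        obtain ⟨L, hL, w⟩ := hxb a ha'
        exact ⟨L, hL, w.symm hsymm⟩
      · obtain ⟨L, hL, w⟩ := ih a ha' b hb'
        exact ⟨L, by simp only [listLength]; linarith, w⟩

end

theorem exists_first_mem {α : Type*} (P : α → Prop) (l : List α) (h : ∃ x ∈ l, P x) :
    ∃ l₁ x l₂, l = l₁ ++ x :: l₂ ∧ P x ∧ ∀ y ∈ l₁, ¬ P y := by
  induction l with
  | nil => simp at h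
  | cons a l ih =>
    by_cases ha : P a
    · exact ⟨[], a, l, rfl, ha, by simp⟩
    · obtain ⟨x, hx, hPx⟩ := h
      rcases List.mem_cons.1 hx with rfl | hx
      · exact absurd hPx ha
      · obtain ⟨l₁, y, l₂, rfl, hy, hl⟩ := ih ⟨x, hx, hPx⟩
        exact ⟨a :: l₁, y, l₂, rfl, hy, by simpa [ha] using hl⟩

theorem exists_last_mem {α : Type*} (P : α → Prop) (l : List α) (h : ∃ x ∈ l, P x) :
    ∃ l₁ x l₂, l = l₁ ++ x :: l₂ ∧ P x ∧ ∀ y ∈ l₂, ¬ P y := by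
  obtain ⟨l₁, x, l₂, hl, hx, h'⟩ := exists_first_mem P l.reverse (by simpa using h)
  refine ⟨l₂.reverse, x, l₁.reverse, ?_, hx, by simpa using h'⟩
  rw [← List.reverse_reverse l, hl]
  simp

section

variable {V : Type*} {s : V → ℕ} {c : V → V} {τ : V → V → ℝ≥0∞} {B : ℝ≥0∞}

/-- Traversing the clusters of one supernode level: a walk jumps from its first to its last visit
of a cluster. -/
theorem traverse_level {R : V → V → Prop} (htri : ∀ a b d, τ a d ≤ τ a b + τ b d)
    (hc : ∀ a b, c a = c b → τ a b = 0) (hR : ∀ a b, R a b → τ a b ≤ B) {l₀ : List V}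
    (hl₀ : l₀.IsChain R) {i N : ℕ}
    (hN : ∀ l, l <:+: l₀ → (∀ x ∈ l, s x ≠ i) → ∀ u v, l.head? = some u → l.getLast? = some v →
      τ u v ≤ N * B) (m : ℕ) (K : Set V) (hK : K.Finite) (hm : K.ncard ≤ m) (l : List V) (hl : l <:+: l₀)
    (hlK : ∀ x ∈ l, s x = i → c x ∈ K) (u v : V) (hu : l.head? = some u)
    (hv : l.getLast? = some v) : τ u v ≤ (m * (N + 2) + N : ℕ) * B := by
  classical
  -- Each cluster accounts for a segment avoiding level `i`, one edge into the cluster and one out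
  -- of it: `N + 2`. After its last visit it is removed from `K`; a final segment adds `N`.
  induction m generalizing K l u with
  | zero =>
    have : K = ∅ := by rwa [Nat.le_zero, Set.ncard_eq_zero hK] at hm
    subst this
    simpa using hN l hl (fun x hx h => hlK x hx h) u v hu hv
  | succ m ih =>
    by_cases hex : ∃ x ∈ l, s x = i
    · obtain ⟨l₁, x, l₂, rfl, hx, hl₁⟩ := exists_first_mem _ l hex
      have hux : τ u x ≤ (N + 1 : ℕ) * B := by
        rcases List.eq_nil_or_concat' l₁ with rfl | ⟨l₁', z, rfl⟩
        · simp only [List.nil_append, List.head?_cons, Option.some.injEq] at hu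
          subst hu
          rw [hc _ _ rfl]; exact zero_le
        · have h1 : τ u z ≤ N * B := by
            refine hN (l₁' ++ [z]) (List.IsInfix.trans ⟨[], x :: l₂, by simp⟩ hl) hl₁ u z ?_ (by simp)
            cases l₁' <;> simpa using hu
          have h2 : τ z x ≤ B := by
            have : ((l₁' ++ [z]) ++ x :: l₂).IsChain R := hl₀.infix hl
            rw [List.isChain_append] at this
            exact hR _ _ (this.2.2 z (by simp) x (by simp))
          calc τ u x ≤ τ u z + τ z x := htri _ _ _
            _ ≤ N * B + B := add_le_add h1 h2
            _ = _ := by push_cast; ring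
      obtain ⟨l₃, y, l₄, hxl, hy, hl₄⟩ := exists_last_mem (fun y => s y = i ∧ c y = c x) (x :: l₂)
        ⟨x, by simp, hx, rfl⟩
      rw [hxl] at hl hv hlK
      have hxy : τ x y = 0 := hc _ _ hy.2.symm
      cases l₄ with
      | nil =>
        have : y = v := by simpa using hv
        subst this
        calc τ u y ≤ τ u x + τ x y := htri _ _ _
          _ ≤ (N + 1 : ℕ) * B + 0 := add_le_add hux hxy.le
          _ ≤ _ := by
            rw [add_zero]
            gcongr ?_ * B
            exact_mod_cast (by nlinarith : N + 1 ≤ (m + 1) * (N + 2) + N)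
      | cons z l₄ =>
        have hyz : τ y z ≤ B := by
          have : ((l₁ ++ l₃) ++ y :: z :: l₄).IsChain R := by
            simpa using hl₀.infix hl
          have := this.right_of_append
          rw [List.isChain_cons_cons] at this
          exact hR _ _ this.1
        have hzv : τ z v ≤ (m * (N + 2) + N : ℕ) * B := by
          refine ih (K \ {c x}) (hK.subset Set.sdiff_subset) ?_ (z :: l₄)
            (List.IsInfix.trans ⟨l₁ ++ l₃ ++ [y], [], by simp⟩ hl) ?_ z (by simp) ?_
          · have hmem : c x ∈ K := by
              rw [← hy.2]; exact hlK y (by simp) hy.1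
            have := Set.ncard_sdiff_singleton_add_one hmem hK
            omega
          · intro w hw hwi
            refine ⟨hlK w (by simp at hw ⊢; tauto) hwi, fun h => hl₄ w hw ⟨hwi, h⟩⟩
          · rw [← hv]; simp [List.getLast?_append, List.getLast?_cons]
        calc τ u v ≤ τ u x + τ x v := htri _ _ _
          _ ≤ τ u x + (τ x y + (τ y z + τ z v)) := by
            gcongr
            exact (htri _ y _).trans (add_le_add_right (htri _ _ _) _)
          _ ≤ (N + 1 : ℕ) * B + (0 + (B + (m * (N + 2) + N : ℕ) * B)) := by
            gcongr; exact hxy.le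
          _ = _ := by push_cast; ring
    · push Not at hex
      calc τ u v ≤ N * B := hN l hl hex u v hu hv
        _ ≤ _ := by gcongr; nlinarith

end

/-- A walk of length less than one can be replaced by a sequence of at most `(6 r + 6) ^ r` edges
of the walk, where one may move for free inside the clusters. -/
theorem IsDecomposition.shortcut {V : Type*} [Finite V] {G : SimpleGraph V} {ω : V → V → ℝ}
    {r : ℕ} {ρ : ℝ} {s : V → ℕ} {A : ℕ → Finset ℕ} {c : V → V}
    (hd : IsDecomposition G ω r ρ s A c) (hω : ∀ u v, G.Adj u v → 0 < ω u v)
    (hsymm : ∀ u v, ω u v = ω v u) {τ : V → V → ℝ≥0∞} {B : ℝ≥0∞}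
    (htri : ∀ a b d, τ a d ≤ τ a b + τ b d) (hc : ∀ a b, c a = c b → τ a b = 0) {l : List V}
    (hl : l.IsChain fun a b => G.Adj a b ∧ τ a b ≤ B) (hlen : listLength ω l < 1) {u v : V}
    (hu : l.head? = some u) (hv : l.getLast? = some v) :
    τ u v ≤ ((6 * r + 6) ^ r : ℕ) * B := by
  classical
  -- `F` collects supernodes that are older than and near to every vertex of the piece. It lies in
  -- `A (s u)`, so it never reaches size `r`, and the recursion has depth at most `r`.
  suffices h : ∀ d, ∀ F : Finset ℕ, r ≤ F.card + d → ∀ l : List V,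
      (l.IsChain fun a b => G.Adj a b ∧ τ a b ≤ B) → listLength ω l < 1 →
      (∀ x ∈ l, ∀ j ∈ F, j < s x ∧ ∃ z, s z = j ∧ ∃ L < 1, WalkIn G ω {w | j ≤ s w} L x z) →
      ∀ u v, l.head? = some u → l.getLast? = some v →
        τ u v ≤ ((6 * r + 6) ^ d - 1 : ℕ) * B by
    refine (h r ∅ (by simp) l hl hlen (by simp) u v hu hv).trans ?_
    gcongr
    exact Nat.sub_le _ _
  intro d
  induction d with
  | zero =>
    intro F hF l _ _ hnear u v hu _
    have huF := hnear u (List.mem_of_mem_head? hu)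
    have hsub : F ⊆ A (s u) := fun j hj => by
      obtain ⟨hju, z, rfl, L, hL, hw⟩ := huF j hj
      exact hd.near u z L hw hju hL
    have := Finset.card_le_card hsub
    have := hd.card_A u
    omega
  | succ d ih =>
    intro F hF l hl hlen hnear u v hu hv
    have hadj : l.IsChain G.Adj := hl.imp fun _ _ h => h.1
    obtain ⟨x₀, hx₀, hmin⟩ := Set.exists_min_image {x | x ∈ l} s (Set.toFinite _)
      ⟨u, List.mem_of_mem_head? hu⟩
    have hmin : ∀ x ∈ l, s x₀ ≤ s x := hmin
    have hx₀ : x₀ ∈ l := hx₀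
    have hwalk := exists_walkIn_of_list hω hsymm (S := {w | s x₀ ≤ s w}) l hadj hmin
    have hx₀F : s x₀ ∉ F := fun hc => (hnear x₀ hx₀ _ hc).1.false
    have hcard : (c '' {x | x ∈ l ∧ s x = s x₀}).ncard ≤ 2 * r := by
      refine hd.hits (s x₀) _ (fun v hv => hv.2) fun a ha b hb => ?_
      obtain ⟨L, hL, w⟩ := hwalk a ha.1 b hb.1
      exact ⟨L, hL.trans_lt hlen, w⟩
    -- Pieces between visits to the oldest supernode `s x₀` avoid it but stay near it, so it joins
    -- `F` for them.
    have key := traverse_level (s := s) (c := c) htri hc (fun a b h => h.2) hl (i := s x₀)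
      (N := (6 * r + 6) ^ d - 1) ?_ (2 * r) _ (Set.toFinite _) hcard l List.infix_rfl
      (fun x hx hxi => ⟨x, ⟨hx, hxi⟩, rfl⟩) u v hu hv
    · refine key.trans ?_
      gcongr
      have h1 : 1 ≤ (6 * r + 6) ^ d := Nat.one_le_pow _ _ (by omega)
      rw [pow_succ]
      generalize (6 * r + 6) ^ d = Y at h1 ⊢
      obtain ⟨Z, rfl⟩ := Nat.exists_eq_add_of_le h1
      have : 2 * r * (1 + Z - 1 + 2) + (1 + Z - 1) + 1 ≤ (1 + Z) * (6 * r + 6) := by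
        rw [Nat.add_sub_cancel_left]; nlinarith
      omega
    · intro l' hl' hne u' v' hu' hv'
      refine ih (insert (s x₀) F) ?_ l' (hl.infix hl')
        ((listLength_le_of_infix hω hl' hadj).trans_lt hlen) ?_ u' v' hu' hv'
      · rw [Finset.card_insert_of_notMem hx₀F]; omega
      · intro x hx j hj
        have hxl := hl'.subset hx
        rcases Finset.mem_insert.1 hj with rfl | hj
        · obtain ⟨L, hL, w⟩ := hwalk x hxl x₀ hx₀
          exact ⟨lt_of_le_of_ne (hmin x hxl) (hne x hx).symm, x₀, rfl, L, hL.trans_lt hlen, w⟩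
        · exact hnear x hxl j hj

/-! ### Clusters at the scale of the distance to the terminals. -/

/-- A partition into clusters whose diameter is at most proportional to `D`, such that walks of
length at most `ε * D u` starting at `u` can be replaced by `h` edges, moving for free inside the
clusters. -/
structure IsClustering {V : Type*} (G : SimpleGraph V) (w : V → V → ℝ) (K : Set V) (D : V → ℝ)
    (h : ℕ) (ε : ℝ) (c : V → V) : Prop where
  eq_self : ∀ t ∈ K, c t = t
  center_le : ∀ v, D (c v) ≤ 2 * D v
  le_center : ∀ v, D v ≤ 2 * D (c v)
  walk : ∀ v, ∃ L ≤ D v, WalkIn G w {u | c u = c v} L v (c v)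
  shortcut : ∀ (τ : V → V → ℝ≥0∞) (B : ℝ≥0∞), (∀ a b d, τ a d ≤ τ a b + τ b d) →
    (∀ a b, c a = c b → τ a b = 0) → ∀ (l : List V) (u v : V), u ∉ K →
    (l.IsChain fun a b => G.Adj a b ∧ τ a b ≤ B) → l.head? = some u → l.getLast? = some v →
    listLength w l ≤ ε * D u → τ u v ≤ h * B

section

variable {V : Type*} {G : SimpleGraph V} {w : V → V → ℝ} {K : Set V} {D : V → ℝ}

/-- The subgraph of the edges that avoid `K`. -/
def avoid (G : SimpleGraph V) (K : Set V) : SimpleGraph V where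
  Adj u v := G.Adj u v ∧ u ∉ K ∧ v ∉ K
  symm := ⟨fun _ _ h => ⟨h.1.symm, h.2.2, h.2.1⟩⟩
  loopless := ⟨fun _ h => h.1.ne rfl⟩

theorem CliqueMinorFree.avoid {r : ℕ} (h : CliqueMinorFree r G) (K : Set V) :
    CliqueMinorFree r (avoid G K) := by
  rintro ⟨B⟩
  refine h ⟨⟨B.branch, fun u => ?_, B.disjoint, fun u v huv => ?_⟩⟩
  · exact (B.connected u).mono fun a b (hab : (SPR.avoid G K).Adj a b) => hab.1
  · obtain ⟨x, hx, y, hy, hxy⟩ := B.adj u v huv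
    exact ⟨x, hx, y, hy, hxy.1⟩

/-- A walk that is short in the rescaled weights is short compared with `D`. -/
theorem WalkIn.of_scaled {κ : ℝ} (hκ : 0 < κ) (hw : ∀ u v, G.Adj u v → 0 < w u v)
    (hD : ∀ v, v ∉ K → 0 < D v)
    (hlip : ∀ u v, G.Adj u v → D u ≤ D v + w u v)
    (hsymm : ∀ u v, w u v = w v u) {S : Set V} {L : ℝ} {u v : V}
    (h : WalkIn (avoid G K) (fun u v => κ * w u v / min (D u) (D v)) S L u v) :
    D v ≤ Real.exp (L / κ) * D u ∧
      ∃ L' ≤ D u * (Real.exp (L / κ) - 1), WalkIn G w S L' u v := by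
  induction h with
  | @nil u hu => simpa using ⟨0, le_rfl, WalkIn.nil hu⟩
  | @cons u v z L hS ha hz ih =>
    obtain ⟨ih1, L', hL', ih2⟩ := ih
    obtain ⟨ha, huK, hvK⟩ := ha
    have hu := hD u huK
    have hv := hD v hvK
    have hm : 0 < min (D u) (D v) := lt_min hu hv
    set x := w u v / min (D u) (D v) with hx
    have hxw : w u v = x * min (D u) (D v) := by rw [hx]; field_simp
    have hx0 : 0 < x := div_pos (hw u v ha) hm
    have hwu : w u v ≤ x * D u := by rw [hxw]; gcongr; exact min_le_left _ _
    have e : (κ * w u v / min (D u) (D v) + L) / κ = x + L / κ := by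
      rw [hx]; field_simp
    have hDv : D v ≤ (1 + x) * D u := by
      have := hlip v u ha.symm
      rw [hsymm v u] at this
      linarith
    -- A discrete Grönwall argument: an edge of rescaled length `κ * x` multiplies `D` by at most `1
    -- + x`.
    have hexp : 1 + x ≤ Real.exp x := by linarith [Real.add_one_le_exp x]
    have hDv' : D v ≤ Real.exp x * D u := hDv.trans (by gcongr)
    rw [e, Real.exp_add]
    have hE := Real.exp_pos (L / κ)
    have hE1 : 1 ≤ Real.exp (L / κ) := by
      have hL0 : 0 ≤ L := hz.nonneg fun a b (hab : (avoid G K).Adj a b) =>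
        div_pos (mul_pos hκ (hw _ _ hab.1)) (lt_min (hD a hab.2.1) (hD b hab.2.2))
      exact Real.one_le_exp (by positivity)
    refine ⟨ih1.trans ?_, w u v + L', ?_, WalkIn.cons hS ha ih2⟩
    · calc Real.exp (L / κ) * D v ≤ Real.exp (L / κ) * (Real.exp x * D u) := by gcongr
        _ = _ := by ring
    · calc w u v + L' ≤ x * D u + (Real.exp x * D u) * (Real.exp (L / κ) - 1) := by
            refine add_le_add hwu (hL'.trans ?_)
            exact mul_le_mul_of_nonneg_right hDv' (by linarith)
        _ ≤ (Real.exp x - 1) * D u + (Real.exp x * D u) * (Real.exp (L / κ) - 1) := by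
            gcongr; linarith
        _ = _ := by ring

theorem scaled_listLength_le {κ θ : ℝ} (hκ : 0 < κ) (hθ : 0 < θ)
    (hw : ∀ u v, G.Adj u v → 0 < w u v) (l : List V) (hl : l.IsChain G.Adj)
    (h : ∀ x ∈ l, θ ≤ D x) :
    listLength (fun u v => κ * w u v / min (D u) (D v)) l ≤ κ / θ * listLength w l := by
  induction l with
  | nil => simp [listLength]
  | cons a l ih =>
    cases l with
    | nil => simp [listLength]
    | cons b l =>
      rw [List.isChain_cons_cons] at hl
      have h1 := ih hl.2 fun x hx => h x (List.mem_cons_of_mem _ hx)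
      have h2 : κ * w a b / min (D a) (D b) ≤ κ * w a b / θ := by
        have := hw a b hl.1
        gcongr
        exact le_min (h a (by simp)) (h b (by simp))
      simp only [listLength]
      calc _ ≤ κ * w a b / θ + κ / θ * listLength w (b :: l) := add_le_add h2 h1
        _ = _ := by ring

theorem abs_sub_le_listLength (hw : ∀ u v, G.Adj u v → 0 < w u v) (hsymm : ∀ u v, w u v = w v u)
    (hlip : ∀ u v, G.Adj u v → D u ≤ D v + w u v) {l : List V} (hl : l.IsChain G.Adj) {u x : V}
    (hu : l.head? = some u) (hx : x ∈ l) :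
    D u ≤ D x + listLength w l ∧ D x ≤ D u + listLength w l := by
  obtain ⟨L, hL, hW⟩ := exists_walkIn_of_list hw hsymm (S := Set.univ) l hl (by simp) u
    (List.mem_of_mem_head? hu) x hx
  have h1 := hW.lipschitz fun a b _ _ hab => hlip a b hab
  have h2 := (hW.symm hsymm).lipschitz fun a b _ _ hab => hlip a b hab
  constructor <;> linarith

/-- The unit-scale decomposition is applied to `avoid G K` with weights divided by the local value
of `D`. Deleting edges keeps the graph minor-free. -/
theorem exists_isClustering [Finite V] [Nonempty V] {r : ℕ} (hG : CliqueMinorFree r G)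
    (hw : ∀ u v, G.Adj u v → 0 < w u v) (hsymm : ∀ u v, w u v = w v u)
    (hDK : ∀ v ∈ K, D v = 0) (hD : ∀ v, v ∉ K → 0 < D v)
    (hlip : ∀ u v, G.Adj u v → D u ≤ D v + w u v) :
    ∃ c, IsClustering G w K D ((6 * r + 6) ^ r) (1 / (8 * (3 * ((r + 1) * r) + 1))) c := by
  have hD0 : ∀ v, 0 ≤ D v := fun v => by
    by_cases hv : v ∈ K
    · exact (hDK v hv).ge
    · exact (hD v hv).le
  set ρ : ℝ := 3 * ((r + 1) * r) + 1 with hρ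
  have hρ1 : 1 ≤ ρ := by rw [hρ]; have : (0 : ℝ) ≤ 3 * ((r + 1) * r) := by positivity
                         linarith
  have hκ : 0 < 2 * ρ := by linarith
  -- The factor `2 * ρ` makes rescaled length `ρ`, the cluster radius, change `D` by at most `exp (1
  -- / 2) ≤ 2`.
  let ω : V → V → ℝ := fun u v => 2 * ρ * w u v / min (D u) (D v)
  have hω : ∀ u v, (avoid G K).Adj u v → 0 < ω u v := fun u v h =>
    div_pos (mul_pos hκ (hw _ _ h.1)) (lt_min (hD u h.2.1) (hD v h.2.2))
  have hωs : ∀ u v, ω u v = ω v u := fun u v => by simp only [ω, hsymm u v, min_comm]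
  obtain ⟨s, A, c, hd⟩ := exists_isDecomposition hω hωs (hG.avoid K)
  have hexp : Real.exp (1 / 2) ≤ 2 := by
    have h1 : Real.exp (1 / 2) * Real.exp (1 / 2) = Real.exp 1 := by
      rw [← Real.exp_add]; norm_num
    have h2 := Real.exp_one_lt_d9
    have h3 := Real.exp_pos (1 / 2)
    nlinarith
  have hexpL : ∀ L ≤ ρ, Real.exp (L / (2 * ρ)) ≤ 2 := fun L hL => by
    refine le_trans (Real.exp_le_exp.2 ?_) hexp
    rw [div_le_div_iff₀ hκ (by norm_num)]
    linarith
  have hscale : ∀ {S : Set V} {L : ℝ} {u v : V}, WalkIn (avoid G K) ω S L u v → L ≤ ρ →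
      D v ≤ 2 * D u ∧ ∃ L' ≤ D u, WalkIn G w S L' u v := fun {S L u v} hW hL => by
    obtain ⟨h1, L', hL', h2⟩ := WalkIn.of_scaled hκ hw hD hlip hsymm hW
    have h3 := hexpL L hL
    have h4 := hD0 u
    refine ⟨h1.trans (by gcongr), L', hL'.trans ?_, h2⟩
    nlinarith
  refine ⟨c, fun t ht => ?_, fun v => ?_, fun v => ?_, fun v => ?_, ?_⟩
  -- Terminals are isolated in `avoid G K`, so the walk to the center is trivial.
  · obtain ⟨L, -, hW⟩ := hd.cluster t
    generalize hz : c t = z at hW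
    cases hW with
    | nil => rfl
    | cons _ ha _ => exact absurd ht ha.2.1
  · obtain ⟨L, hL, hW⟩ := hd.cluster v
    exact (hscale hW hL).1
  · obtain ⟨L, hL, hW⟩ := hd.cluster v
    exact (hscale (hW.symm hωs) hL).1
  · obtain ⟨L, hL, hW⟩ := hd.cluster v
    exact (hscale hW hL).2
  · intro τ B htri hc l u v huK hl hu hv hlen
    have hladj : l.IsChain G.Adj := hl.imp fun _ _ h => h.1
    have hDu := hD u huK
    -- A walk this short keeps `D` above half its initial value, so it avoids `K` and its rescaled
    -- length is at most `1 / 2`.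
    have hhalf : ∀ x ∈ l, D u / 2 ≤ D x := fun x hx => by
      have h1 := (abs_sub_le_listLength hw hsymm hlip hladj hu hx).1
      have h2 : 1 / (8 * ρ) * D u ≤ 1 / 2 * D u := by
        gcongr; linarith
      linarith
    have hxK : ∀ x ∈ l, x ∉ K := fun x hx hc => by
      have := hhalf x hx
      rw [hDK x hc] at this
      linarith
    refine hd.shortcut hω hωs htri hc (l := l) ?_ ?_ hu hv
    · exact hl.imp_of_mem_imp fun a b ha hb hab => ⟨⟨hab.1, hxK a ha, hxK b hb⟩, hab.2⟩
    · have h1 := scaled_listLength_le hκ (half_pos hDu) hw l hladj hhalf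
      refine h1.trans_lt ?_
      calc 2 * ρ / (D u / 2) * listLength w l ≤ 2 * ρ / (D u / 2) * (1 / (8 * ρ) * D u) := by gcongr
        _ = 1 / 2 := by field_simp; norm_num
        _ < 1 := by norm_num

end

/-! ### Distance to the terminals and Voronoi cells. -/

variable {V : Type*} {G : SimpleGraph V} {w : V → V → ℝ} {K : Set V} {D : V → ℝ}

/-- The function `D` is the distance to `K`, capped on the components that avoid `K`. -/
structure IsTerminalDist (G : SimpleGraph V) (w : V → V → ℝ) (K : Set V) (D : V → ℝ) : Prop where
  eq_zero : ∀ v ∈ K, D v = 0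
  pos : ∀ v, v ∉ K → 0 < D v
  lip : ∀ u v, G.Adj u v → D u ≤ D v + w u v
  tight : ∀ v, v ∉ K → ∀ t ∈ K, ∀ L, WalkIn G w Set.univ L v t →
    ∃ p, G.Adj v p ∧ D v = D p + w v p

theorem exists_isTerminalDist [Finite V] (hw : ∀ u v, G.Adj u v → 0 < w u v) (K : Set V) :
    ∃ D, IsTerminalDist G w K D := by
  classical
  have hlen : ∀ v, ∃ L, (∃ t ∈ K, ∃ L, WalkIn G w Set.univ L v t) →
      ∃ t ∈ K, WalkIn G w Set.univ L v t := fun v => by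
    by_cases h : ∃ t ∈ K, ∃ L, WalkIn G w Set.univ L v t
    · obtain ⟨t, ht, L, hW⟩ := h
      exact ⟨L, fun _ => ⟨t, ht, hW⟩⟩
    · exact ⟨0, fun h' => absurd h' h⟩
  choose len hlen using hlen
  obtain ⟨M₀, hM₀⟩ := (Set.finite_range len).bddAbove
  have hM : ∀ u, len u < max M₀ 0 + 1 := fun u => by
    have := hM₀ ⟨u, rfl⟩
    have := le_max_left M₀ 0
    linarith
  have hM0 : 0 < max M₀ 0 + 1 := by
    have := le_max_right M₀ 0
    linarith
  -- The cap exceeds a walk length to `K` from each vertex that has one, so it is attained only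
  -- where no terminal is reachable.
  obtain ⟨D, hφ, hlip, htight, hlow⟩ := exists_potential G.Adj w (fun u v h => (hw u v h).le)
    (fun v => if v ∈ K then 0 else max M₀ 0 + 1)
  have hD0 : ∀ v, 0 ≤ D v := hlow 0 fun v => by split_ifs <;> linarith
  have hK : ∀ v ∈ K, D v = 0 := fun v hv =>
    le_antisymm (by simpa [hv] using hφ v) (hD0 v)
  refine ⟨D, hK, fun v hv => ?_, hlip, fun v hv t ht L hW => ?_⟩
  · rcases htight v with h | ⟨p, hp, h⟩
    · rw [h, if_neg hv]; exact hM0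
    · have := hw v p hp
      have := hD0 p
      linarith
  · rcases htight v with h | h
    · rw [if_neg hv] at h
      obtain ⟨t', ht', hW'⟩ := hlen v ⟨t, ht, L, hW⟩
      have h1 := hW'.lipschitz fun a b _ _ hab => hlip a b hab
      rw [hK t' ht'] at h1
      have := hM v
      linarith
    · exact h

theorem listLength_concat (ω : V → V → ℝ) (l : List V) (u v : V) (h : l.getLast? = some u) :
    listLength ω (l ++ [v]) = listLength ω l + ω u v := by
  induction l with
  | nil => simp at h
  | cons a l ih =>
    cases l with
    | nil =>
      have : a = u := by simpa using h
      subst this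
      simp [listLength]
    | cons b l =>
      have := ih (by simpa using h)
      simp only [List.cons_append, listLength] at this ⊢
      rw [this, add_assoc]

namespace IsTerminalDist

theorem nonneg (hD : IsTerminalDist G w K D) (v : V) : 0 ≤ D v := by
  by_cases hv : v ∈ K
  · exact (hD.eq_zero v hv).ge
  · exact (hD.pos v hv).le

/-- A shortest path to `K` is followed until `D` falls below the threshold `θ`. -/
theorem exists_descent [Finite V] (hD : IsTerminalDist G w K D)
    (hw : ∀ u v, G.Adj u v → 0 < w u v) {θ : ℝ} (hθ : 0 < θ)
    {v : V} (hv : v ∉ K) {t : V} (ht : t ∈ K) {L : ℝ} (hW : WalkIn G w Set.univ L v t)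
    (hvθ : θ ≤ D v) :
    ∃ (l : List V) (z y : V), (l.IsChain fun a b => G.Adj a b ∧ w a b ≤ D a) ∧ l.head? = some v ∧ l.getLast? = some z ∧
      (∀ x ∈ l, D x ≤ D v) ∧ listLength w l = D v - D z ∧ θ ≤ D z ∧
      G.Adj z y ∧ D z = D y + w z y ∧ D y < θ ∧ ∃ L, WalkIn G w Set.univ L y t := by
  classical
  let N : Set V := {v | v ∉ K ∧ ∃ L, WalkIn G w Set.univ L v t}
  have hpar : ∀ v, ∃ p, v ∈ N → G.Adj v p ∧ D v = D p + w v p := fun v => by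
    by_cases h : v ∈ N
    · obtain ⟨L, hL⟩ := h.2
      obtain ⟨p, hp⟩ := hD.tight v h.1 t ht L hL
      exact ⟨p, fun _ => hp⟩
    · exact ⟨v, fun h' => absurd h' h⟩
  choose par hpar using hpar
  have hlt : ∀ v ∈ N, D (par v) < D v := fun v hv => by
    have := hpar v hv
    have := hw _ _ this.1
    linarith
  have hvN : v ∈ N := ⟨hv, L, hW⟩
  clear hW L hv
  revert hvN hvθ
  induction v using descent_induction hlt with
  | h0 v hv => exact fun _ h => absurd h hv
  | h1 v hv ih =>
    intro hvθ _
    obtain ⟨hadj, hDv⟩ := hpar v hv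
    have hpos := hw _ _ hadj
    obtain ⟨L, hW⟩ := hv.2
    have hpW : WalkIn G w Set.univ (w (par v) v + L) (par v) t :=
      WalkIn.cons (Set.mem_univ _) hadj.symm hW
    by_cases hp : θ ≤ D (par v)
    · have hpK : par v ∉ K := fun hc => by
        rw [hD.eq_zero _ hc] at hp
        linarith
      obtain ⟨l, z, y, hl, hhd, hlast, hle, hlen, hz⟩ := ih hp ⟨hpK, _, hpW⟩
      cases l with
      | nil => simp at hhd
      | cons a l =>
        have ha : a = par v := by simpa using hhd
        subst ha
        refine ⟨v :: par v :: l, z, y, List.isChain_cons_cons.2 ⟨⟨hadj, by linarith [hD.nonneg (par v)]⟩, hl⟩, rfl,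
          by simpa using hlast, fun x hx => ?_, ?_, hz⟩
        · rcases List.mem_cons.1 hx with rfl | hx
          · exact le_rfl
          · exact (hle x hx).trans (hlt v hv).le
        · simp only [listLength, hlen]; linarith
    · exact ⟨[v], v, par v, List.isChain_singleton _, rfl, rfl, by simp, by simp [listLength], hvθ,
        hadj, hDv, not_le.1 hp, _, hpW⟩

end IsTerminalDist

/-- The Voronoi cells of the terminals in the cluster graph: `F v` is the terminal whose cell
contains `v`. -/
theorem IsClustering.exists_voronoi [Finite V] {h : ℕ} {ε : ℝ} {c : V → V}
    (hc : IsClustering G w K D h ε c) (hD : IsTerminalDist G w K D)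
    (hw : ∀ u v, G.Adj u v → 0 < w u v) (hsymm : ∀ u v, w u v = w v u) (hε : 0 < ε) (hε1 : ε < 1) :
    ∃ F : V → V, (∀ t ∈ K, F t = t) ∧ (∀ u v, c u = c v → F u = F v) ∧
      (∀ v, ∃ L, WalkIn G w {u | F u = F v} L v (F v)) ∧
      ∀ v, ∀ t ∈ K, ∀ L, WalkIn G w Set.univ L v t → F v ∈ K ∧
        ∃ L' ≤ (1 + 16 * (h + 1) / ε) * D v, WalkIn G w {u | F u = F v} L' v (F v) := by
  classical
  -- The solution of `Λ = (1 - ε) * Λ + 4 * (h + 1)`: lowering `D` by the factor `1 - ε` costs `h +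
  -- 1` edges of price at most `4 * D v`.
  set Λ : ℝ := 4 * (h + 1) / ε with hΛ
  have hΛ0 : 0 < Λ := by positivity
  have hD0 := hD.nonneg
  obtain ⟨M, hM⟩ := (Set.finite_range D).bddAbove
  have hM : ∀ v, D v ≤ M := fun v => hM ⟨v, rfl⟩
  -- Long edges are excluded so that the price `D a + D b` controls true length: crossing both
  -- clusters and the edge takes at most four times that.
  let R : V → V → Prop := fun a b => ∃ x y, G.Adj x y ∧ c x = a ∧ c y = b ∧ w x y ≤ D x + D y
  obtain ⟨Φ, hφ, hlip, htight, hlow⟩ := exists_potential R (fun a b => D a + D b)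
    (fun a b _ => add_nonneg (hD0 a) (hD0 b)) (fun v => if v ∈ K then 0 else Λ * (max M 0) + 1)
  have hM' : 0 < Λ * (max M 0) + 1 := by positivity
  have hΦ0 : ∀ v, 0 ≤ Φ v := hlow 0 fun v => by split_ifs <;> linarith
  have hΦK : ∀ v ∈ K, Φ v = 0 := fun v hv =>
    le_antisymm (by simpa [hv] using hφ v) (hΦ0 v)
  have hedge : ∀ x y, G.Adj x y → w x y ≤ D x + D y → Φ (c x) ≤ Φ (c y) + 2 * (D x + D y) :=
    fun x y hxy hle => by
      have h1 := hlip (c x) (c y) ⟨x, y, hxy, rfl, rfl, hle⟩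
      have h2 := hc.center_le x
      have h3 := hc.center_le y
      linarith
  have hbound : ∀ v, ∀ t ∈ K, ∀ L, WalkIn G w Set.univ L v t → Φ (c v) ≤ Λ * D v := by
    have wf : WellFounded (fun a b : V => D a < D b) := by
      have : Std.Irrefl (fun a b : V => D a < D b) := ⟨fun a => lt_irrefl _⟩
      have : IsTrans V (fun a b : V => D a < D b) := ⟨fun a b c => lt_trans⟩
      exact Finite.wellFounded_of_trans_of_irrefl _
    intro v
    induction v using wf.induction with
    | _ v ih =>
      intro t ht L hW
      by_cases hv : v ∈ K
      · rw [hc.eq_self v hv, hΦK v hv]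
        exact mul_nonneg hΛ0.le (hD0 v)
      have hDv := hD.pos v hv
      obtain ⟨l, z, y, hl, hhd, hlast, hle, hlen, hz, hzy, hDz, hy, L', hyW⟩ :=
        hD.exists_descent hw (θ := (1 - ε) * D v) (mul_pos (by linarith) hDv) hv ht hW
          (by nlinarith)
      have hzv : D z ≤ D v := hle z (List.mem_of_mem_getLast? hlast)
      have hwzy := hw z y hzy
      have h1 : Φ (c y) ≤ Λ * D y := ih y (by linarith) t ht L' hyW
      have h2 : Φ (c z) ≤ Φ (c y) + 4 * D v := by
        have := hedge z y hzy (by linarith [hD0 y])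
        linarith
      have h3 : Φ (c v) - Φ (c z) ≤ h * (4 * D v) := by
        -- Truncated differences of the potential satisfy the triangle inequality and vanish inside
        -- clusters; symmetry is not needed.
        have key := hc.shortcut (fun a b => ENNReal.ofReal (Φ (c a) - Φ (c b)))
          (ENNReal.ofReal (4 * D v)) (fun a b d => ?_) (fun a b hab => by simp [hab]) l v z hv ?_
          hhd hlast ?_
        · rw [← ENNReal.ofReal_natCast, ← ENNReal.ofReal_mul (Nat.cast_nonneg _)] at key
          exact (ENNReal.ofReal_le_ofReal_iff (by positivity)).1 key
        · rw [show Φ (c a) - Φ (c d) = (Φ (c a) - Φ (c b)) + (Φ (c b) - Φ (c d)) by ring]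
          exact ENNReal.ofReal_add_le
        · refine hl.imp_of_mem_imp fun a b ha hb hab => ⟨hab.1, ENNReal.ofReal_le_ofReal ?_⟩
          have := hedge a b hab.1 (by linarith [hab.2, hD0 b])
          linarith [hle a ha, hle b hb]
        · rw [hlen]; linarith
      have h4 : Λ * ε = 4 * (h + 1) := by rw [hΛ]; field_simp
      have h5 : Λ * D y ≤ Λ * ((1 - ε) * D v) := by gcongr
      have h6 : Λ * ((1 - ε) * D v) = Λ * D v - (4 * (h + 1)) * D v := by rw [← h4]; ring
      linarith
  let N : Set V := {a | a ∉ K ∧ Φ a < Λ * (max M 0) + 1}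
  have hpar : ∀ a, ∃ b, a ∈ N → R a b ∧ Φ a = Φ b + (D a + D b) := fun a => by
    by_cases ha : a ∈ N
    · rcases htight a with h' | ⟨b, hb⟩
      · rw [if_neg ha.1] at h'
        exact absurd h' ha.2.ne
      · exact ⟨b, fun _ => hb⟩
    · exact ⟨a, fun h => absurd h ha⟩
  choose par hpar using hpar
  have hlt : ∀ a ∈ N, Φ (par a) < Φ a := fun a ha => by
    have h1 := hpar a ha
    have h2 := hD.pos a ha.1
    have h3 := hD0 (par a)
    linarith
  obtain ⟨f, hf0, hf1, hf2⟩ := exists_root hlt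
  have hidem : ∀ v, c (c v) = c v := fun v => by
    obtain ⟨_, _, W⟩ := hc.walk v
    exact W.right_mem
  have hfw : ∀ a, c a = a → (∃ L ≤ 4 * Φ a, WalkIn G w {u | f (c u) = f a} L a (f a)) ∧
      Φ (f a) ≤ Φ a := fun a => by
    induction a using descent_induction hlt with
    | h0 a ha =>
      intro hca
      rw [hf0 a ha]
      refine ⟨⟨0, by linarith [hΦ0 a], WalkIn.nil ?_⟩, le_rfl⟩
      simp [hca, hf0 a ha]
    | h1 a ha ih =>
      intro hca
      obtain ⟨⟨x, y, hxy, hx, hy, hle⟩, hΦ⟩ := hpar a ha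
      obtain ⟨⟨L₃, hL₃, W₃⟩, hle'⟩ := ih (by rw [← hy]; exact hidem y)
      obtain ⟨L₁, hL₁, W₁⟩ := hc.walk x
      obtain ⟨L₂, hL₂, W₂⟩ := hc.walk y
      have h1 := hc.le_center x
      have h2 := hc.le_center y
      rw [hx] at h1 W₁
      rw [hy] at h2 W₂
      have hfa := hf1 a ha
      have e1 : {u | c u = a} ⊆ {u | f (c u) = f a} := fun u hu => congrArg f hu
      have e2 : {u | c u = par a} ⊆ {u | f (c u) = f a} := fun u hu =>
        (congrArg f hu).trans hfa.symm
      rw [← hfa] at W₃ hle'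
      refine ⟨⟨L₁ + (w x y + (L₂ + L₃)), by linarith,
        ((W₁.symm hsymm).mono e1).trans (WalkIn.cons (e1 hx) hxy ((W₂.mono e2).trans W₃))⟩, ?_⟩
      exact hle'.trans (hlt a ha).le
  refine ⟨fun v => f (c v), fun t ht => ?_, fun u v huv => congrArg f huv, fun v => ?_,
    fun v t ht L hW => ?_⟩
  · simp only [hc.eq_self t ht]
    exact hf0 t fun h => h.1 ht
  · obtain ⟨L₁, hL₁, W₁⟩ := hc.walk v
    obtain ⟨⟨L₂, hL₂, W₂⟩, -⟩ := hfw (c v) (hidem v)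
    exact ⟨_, (W₁.mono fun u hu => congrArg f hu).trans W₂⟩
  · obtain ⟨L₁, hL₁, W₁⟩ := hc.walk v
    obtain ⟨⟨L₂, hL₂, W₂⟩, hle⟩ := hfw (c v) (hidem v)
    have h1 := hbound v t ht L hW
    refine ⟨?_, L₁ + L₂, ?_, (W₁.mono fun u hu => congrArg f hu).trans W₂⟩
    -- The root's potential is below the cap, so following pointers could stop only at a terminal.
    · by_contra hfK
      refine hf2 (c v) ⟨hfK, hle.trans_lt (h1.trans_lt ?_)⟩
      have : Λ * D v ≤ Λ * max M 0 := by gcongr; exact (hM v).trans (le_max_left _ _)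
      linarith
    · have : (1 + 16 * (h + 1) / ε) * D v = D v + 4 * (Λ * D v) := by rw [hΛ]; ring
      rw [this]
      linarith

end SPR

/-! ### The minor and its distortion for positive weights. -/

namespace SPR

section

variable {V : Type*} {G : SimpleGraph V} {w : Sym2 V → ℝ≥0}

theorem wdist_le_walkLength {u v : V} (p : G.Walk u v) : wdist G w u v ≤ walkLength w p :=
  iInf_le _ p

theorem wdist_self (u : V) : wdist G w u u = 0 :=
  le_antisymm ((wdist_le_walkLength SimpleGraph.Walk.nil).trans (by simp [walkLength])) zero_le

theorem wdist_triangle (u v z : V) : wdist G w u z ≤ wdist G w u v + wdist G w v z := by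
  refine ENNReal.le_iInf_add_iInf fun p q => (wdist_le_walkLength (p.append q)).trans ?_
  simp [walkLength, SimpleGraph.Walk.edges_append]

theorem wdist_comm (u v : V) : wdist G w u v = wdist G w v u := by
  have h : ∀ u v : V, wdist G w u v ≤ wdist G w v u := fun u v => by
    refine le_iInf fun p => (wdist_le_walkLength p.reverse).trans ?_
    simp [walkLength, SimpleGraph.Walk.edges_reverse, List.map_reverse, List.sum_reverse]
  exact le_antisymm (h u v) (h v u)

theorem wdist_le_of_adj {u v : V} (h : G.Adj u v) : wdist G w u v ≤ w s(u, v) := by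
  refine (wdist_le_walkLength h.toWalk).trans ?_
  simp [walkLength]

theorem wdist_mono {w' : Sym2 V → ℝ≥0} (h : ∀ e ∈ G.edgeSet, w e ≤ w' e) (u v : V) :
    wdist G w u v ≤ wdist G w' u v := by
  refine iInf_mono fun p => ?_
  have : walkLength w p ≤ walkLength w' p :=
    List.sum_le_sum fun e he => h e (p.edges_subset_edgeSet he)
  exact_mod_cast this

theorem WalkIn.exists_walk {S : Set V} {L : ℝ} {u v : V}
    (h : WalkIn G (fun u v => (w s(u, v) : ℝ)) S L u v) :
    ∃ p : G.Walk u v, (walkLength w p : ℝ) = L := by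
  induction h with
  | nil _ => exact ⟨SimpleGraph.Walk.nil, by simp [walkLength]⟩
  | cons _ ha _ ih =>
    obtain ⟨p, rfl⟩ := ih
    exact ⟨SimpleGraph.Walk.cons ha p, by simp [walkLength]⟩

theorem WalkIn.wdist_le {S : Set V} {L : ℝ} {u v : V}
    (h : WalkIn G (fun u v => (w s(u, v) : ℝ)) S L u v) : wdist G w u v ≤ ENNReal.ofReal L := by
  obtain ⟨p, rfl⟩ := h.exists_walk
  rw [ENNReal.ofReal_coe_nnreal]
  exact wdist_le_walkLength p

theorem walkIn_of_walk {u v : V} (p : G.Walk u v) :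
    WalkIn G (fun u v => (w s(u, v) : ℝ)) Set.univ (walkLength w p) u v := by
  induction p with
  | nil => simpa [walkLength] using WalkIn.nil (Set.mem_univ _)
  | cons h p ih =>
    have := WalkIn.cons (ω := fun u v => (w s(u, v) : ℝ)) (Set.mem_univ _) h ih
    simpa [walkLength] using this

/-- Every edge of a graph on `K` weighted by the distance in `G` of its endpoints. -/
noncomputable def distWeight (G : SimpleGraph V) (w : Sym2 V → ℝ≥0) (K : Set V) : Sym2 K → ℝ≥0 :=
  Sym2.lift ⟨fun s t => (wdist G w s t).toNNReal, fun s t => by simp only; rw [wdist_comm]⟩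

/-- An edge of `M` joins two connected branch sets containing the terminals, so `toNNReal` in
`distWeight` loses nothing on edges. -/
theorem MinorModel.wdist_ne_top {K : Set V} {M : SimpleGraph K} (B : MinorModel M G)
    (hB : ∀ t : K, (t : V) ∈ B.branch t) (w : Sym2 V → ℝ≥0) {s t : K} (h : M.Adj s t) :
    wdist G w s t ≠ ⊤ := by
  obtain ⟨x, hx, y, hy, hxy⟩ := B.adj s t h
  have key : ∀ (t : K) (x : V), x ∈ B.branch t → G.Reachable t x := fun t x hx =>
    ((B.connected t).preconnected ⟨t, hB t⟩ ⟨x, hx⟩).map (SimpleGraph.Embedding.induce _).toHom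
  obtain ⟨p⟩ := ((key s x hx).trans hxy.reachable).trans (key t y hy).symm
  exact ne_top_of_le_ne_top ENNReal.coe_ne_top (wdist_le_walkLength p)

theorem MinorModel.coe_distWeight {K : Set V} {M : SimpleGraph K} (B : MinorModel M G)
    (hB : ∀ t : K, (t : V) ∈ B.branch t) (w : Sym2 V → ℝ≥0) {s t : K} (h : M.Adj s t) :
    (distWeight G w K s(s, t) : ℝ≥0∞) = wdist G w s t :=
  ENNReal.coe_toNNReal (B.wdist_ne_top hB w h)

theorem wdist_le_wdist_of_weight {K : Set V} {M : SimpleGraph K} {wM : Sym2 K → ℝ≥0}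
    (h : ∀ s t, M.Adj s t → (wM s(s, t) : ℝ≥0∞) = wdist G w s t) (s t : K) :
    wdist G w s t ≤ wdist M wM s t := by
  refine le_iInf fun p => ?_
  induction p with
  | nil => simp [wdist_self]
  | @cons a b d hab p ih =>
    refine (wdist_triangle (a : V) b d).trans ?_
    rw [← h a b hab]
    simpa [walkLength] using ih

end

theorem isChain_le_listLength {V : Type*} {G : SimpleGraph V} {ω : V → V → ℝ}
    (hω : ∀ u v, G.Adj u v → 0 < ω u v) (l : List V) (hl : l.IsChain G.Adj) :
    l.IsChain fun a b => G.Adj a b ∧ ω a b ≤ listLength ω l := by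
  induction l with
  | nil => exact List.isChain_nil
  | cons a l ih =>
    cases l with
    | nil => exact List.isChain_singleton _
    | cons b l =>
      rw [List.isChain_cons_cons] at hl ⊢
      have h1 := listLength_nonneg hω _ hl.2
      have h2 := hω a b hl.1
      refine ⟨⟨hl.1, by simp only [listLength]; linarith⟩, (ih hl.2).imp fun x y h => ⟨h.1, ?_⟩⟩
      have := h.2
      simp only [listLength] at this ⊢
      linarith

/-- The distortion that is obtained for `K_r`-minor-free graphs. -/
noncomputable def distortion (h ε : ℝ) : ℝ :=
  (h * (4 * (1 + 16 * (h + 1) / ε) + 1) + 4 * (1 + 16 * (h + 1) / ε)) / ε +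
    (1 + 16 * (h + 1) / ε) + 1

/-- The branch sets are the Voronoi cells. An edge of `G` between two cells gives an edge of `M`
whose weight is bounded by going from one terminal through that edge to the other. -/
theorem IsClustering.exists_minor {V : Type*} [Finite V] {G : SimpleGraph V} {w : Sym2 V → ℝ≥0}
    {K : Set V} {D : V → ℝ} {h : ℕ} {ε : ℝ} {c : V → V}
    (hc : IsClustering G (fun u v => (w s(u, v) : ℝ)) K D h ε c)
    (hD : IsTerminalDist G (fun u v => (w s(u, v) : ℝ)) K D) (hw : ∀ e, 0 < w e)
    (hε : 0 < ε) (hε1 : ε < 1) :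
    ∃ M : SimpleGraph K, (∃ B : MinorModel M G, ∀ t : K, (t : V) ∈ B.branch t) ∧
      ∀ s t : K, wdist M (distWeight G w K) s t ≤
        ENNReal.ofReal (distortion h ε) * wdist G w s t := by
  classical
  let ω : V → V → ℝ := fun u v => (w s(u, v) : ℝ)
  have hω : ∀ u v, G.Adj u v → 0 < ω u v := fun u v _ => hw _
  have hsymm : ∀ u v, ω u v = ω v u := fun u v => by simp only [ω, Sym2.eq_swap]
  obtain ⟨F, hFK, hFc, hFw, hFg⟩ := hc.exists_voronoi hD hω hsymm hε hε1
  let M : SimpleGraph K :=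
    { Adj := fun s t => s ≠ t ∧ ∃ x y, G.Adj x y ∧ F x = s ∧ F y = t
      symm := ⟨fun s t ⟨hne, x, y, hxy, hx, hy⟩ => ⟨hne.symm, y, x, hxy.symm, hy, hx⟩⟩
      loopless := ⟨fun s hs => hs.1 rfl⟩ }
  let B : MinorModel M G :=
    { branch := fun t => {u | F u = t}
      connected := fun t => induce_connected (ω := ω) (t : V) ⟨t, hFK t t.2⟩ fun v hv => by
        have hv' : F v = t := hv
        have := hFw v
        rwa [hv'] at this
      disjoint := fun s t hne => Set.disjoint_left.2 fun v hv hv' =>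
        hne (Subtype.ext ((show F v = s from hv).symm.trans hv'))
      adj := fun s t ⟨_, x, y, hxy, hx, hy⟩ => ⟨x, hx, y, hy, hxy⟩ }
  have hB : ∀ t : K, (t : V) ∈ B.branch t := fun t => hFK t t.2
  refine ⟨M, ⟨B, hB⟩, fun s₀ t₀ => ?_⟩
  set Λ : ℝ := 1 + 16 * (h + 1) / ε with hΛ
  have hΛ0 : 0 < Λ := by positivity
  have hα : distortion h ε = (h * (4 * Λ + 1) + 4 * Λ) / ε + Λ + 1 := rfl
  have hα0 : 0 < distortion h ε := by rw [hα]; positivity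
  have hD0 := hD.nonneg
  -- The default `t₀` is harmless: vertices from which `t₀` is reachable have their `F` in `K`.
  let T : V → K := fun v => if hv : F v ∈ K then ⟨F v, hv⟩ else t₀
  have hT : ∀ t : K, T t = t := fun t => by
    have : F t = t := hFK t t.2
    simp only [T, this, t.2, dite_true]
  let τ : V → V → ℝ≥0∞ := fun a b => wdist M (distWeight G w K) (T a) (T b)
  have htri : ∀ a b d, τ a d ≤ τ a b + τ b d := fun a b d => wdist_triangle _ _ _
  have hτc : ∀ a b, c a = c b → τ a b = 0 := fun a b hab => by
    have : T a = T b := by simp only [T, hFc a b hab]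
    simp only [τ, this, wdist_self]
  have hedge : ∀ x y L, G.Adj x y → WalkIn G ω Set.univ L x t₀ →
      τ x y ≤ ENNReal.ofReal (Λ * D x + (ω x y + Λ * D y)) := fun x y L hxy hW => by
    obtain ⟨hxK, L₁, hL₁, W₁⟩ := hFg x t₀ t₀.2 L hW
    obtain ⟨hyK, L₂, hL₂, W₂⟩ := hFg y t₀ t₀.2 _ (WalkIn.cons (Set.mem_univ _) hxy.symm hW)
    have hTx : T x = ⟨F x, hxK⟩ := dif_pos hxK
    have hTy : T y = ⟨F y, hyK⟩ := dif_pos hyK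
    by_cases hne : T x = T y
    · simp only [τ, hne, wdist_self]; exact zero_le
    · have hadj : M.Adj (T x) (T y) := ⟨hne, x, y, hxy, by rw [hTx], by rw [hTy]⟩
      refine (wdist_le_of_adj hadj).trans ?_
      rw [B.coe_distWeight hB w hadj, hTx, hTy]
      have W : WalkIn G ω Set.univ (L₁ + (ω x y + L₂)) (F x) (F y) :=
        ((W₁.symm hsymm).mono (Set.subset_univ _)).trans
          (WalkIn.cons (Set.mem_univ _) hxy (W₂.mono (Set.subset_univ _)))
      exact W.wdist_le.trans (ENNReal.ofReal_le_ofReal (by linarith))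
  -- The list `l` is the current piece, from `x₀` to `u`, and `L` is the length still to go. A piece
  -- starting in `K` stays a single vertex because `D x₀ = 0`.
  have main : ∀ L u t, WalkIn G ω Set.univ L u t → t = (t₀ : V) → ∀ (x₀ : V) (l : List V),
      l.IsChain G.Adj → l.head? = some x₀ → l.getLast? = some u → (x₀ ∈ K → u = x₀) →
      listLength ω l ≤ ε * D x₀ →
        τ x₀ t₀ ≤ ENNReal.ofReal (distortion h ε * (listLength ω l + L)) := by
    intro L u t hW
    induction hW with
    | @nil u hu =>
      intro hut x₀ l hl hhd hlast hx₀ hlen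
      subst hut
      by_cases hK : x₀ ∈ K
      · simp only [τ, hx₀ hK, wdist_self]; exact zero_le
      -- A piece starting outside `K` cannot end at a terminal: `D` would drop to zero within length
      -- `ε * D x₀ < D x₀`.
      · have h1 := (abs_sub_le_listLength hω hsymm hD.lip hl hhd (List.mem_of_mem_getLast? hlast)).1
        rw [hD.eq_zero _ t₀.2] at h1
        have h2 := hD.pos x₀ hK
        nlinarith
    | @cons u v z L hu huv hvz ih =>
      intro hz x₀ l hl hhd hlast hx₀ hlen
      have hpos := hω u v huv
      have hl0 := listLength_nonneg hω l hl
      have hL0 := hvz.nonneg hω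
      have hlen' := listLength_concat ω l u v hlast
      -- The piece is extended while it fits. Otherwise it is shortcut and closed by the edge from
      -- `u` to `v`, and a new piece starts at `v`.
      by_cases hext : listLength ω l + ω u v ≤ ε * D x₀
      · have hxK : x₀ ∉ K := fun hc => by
          rw [hD.eq_zero _ hc] at hext
          linarith
        have := ih hz x₀ (l ++ [v]) ?_ ?_ (by simp) (fun hc => absurd hc hxK) (by rwa [hlen'])
        · rwa [hlen', add_assoc] at this
        · rw [List.isChain_append]
          refine ⟨hl, List.isChain_singleton _, fun a ha b hb => ?_⟩
          rw [hlast] at ha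
          simp only [Option.mem_def, Option.some.injEq, List.head?_cons] at ha hb
          subst ha hb
          exact huv
        · simp [List.head?_append, hhd]
      · push Not at hext
        have huW : WalkIn G ω Set.univ (ω u v + L) u t₀ := hz ▸ WalkIn.cons hu huv hvz
        have hwalk := exists_walkIn_of_list hω hsymm (S := Set.univ) l hl (by simp)
        have hul : u ∈ l := List.mem_of_mem_getLast? hlast
        have hDx : ∀ x ∈ l, D x ≤ 2 * D x₀ := fun x hx => by
          have h1 := (abs_sub_le_listLength hω hsymm hD.lip hl hhd hx).2
          have h2 : ε * D x₀ ≤ 1 * D x₀ := by have := hD0 x₀; gcongr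
          linarith
        have h1 : τ x₀ u ≤ ENNReal.ofReal (h * ((4 * Λ + 1) * D x₀)) := by
          by_cases hK : x₀ ∈ K
          · simp only [τ, hx₀ hK, wdist_self]; exact zero_le
          · rw [ENNReal.ofReal_mul (Nat.cast_nonneg _), ENNReal.ofReal_natCast]
            refine hc.shortcut τ _ htri hτc l x₀ u hK ?_ hhd hlast hlen
            refine (isChain_le_listLength hω l hl).imp_of_mem_imp fun a b ha hb hab => ⟨hab.1, ?_⟩
            obtain ⟨L', -, W⟩ := hwalk a ha u hul
            refine (hedge a b _ hab.1 (W.trans huW)).trans (ENNReal.ofReal_le_ofReal ?_)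
            have e1 : Λ * D a ≤ Λ * (2 * D x₀) := by gcongr; exact hDx a ha
            have e2 : Λ * D b ≤ Λ * (2 * D x₀) := by gcongr; exact hDx b hb
            have e3 : ε * D x₀ ≤ 1 * D x₀ := by have := hD0 x₀; gcongr
            linarith [hab.2]
        have h2 : τ u v ≤ ENNReal.ofReal (4 * Λ * D x₀ + (Λ + 1) * ω u v) := by
          refine (hedge u v _ huv huW).trans (ENNReal.ofReal_le_ofReal ?_)
          have h3 := hD.lip v u huv.symm
          have h4 : ω v u = ω u v := hsymm v u
          have h5 : Λ * D v ≤ Λ * (D u + ω u v) := by gcongr; linarith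
          have h6 : Λ * D u ≤ Λ * (2 * D x₀) := by gcongr; exact hDx u hul
          linarith
        have h3 := ih hz v [v] (List.isChain_singleton _) rfl rfl (fun _ => rfl)
          (by simp only [listLength]; exact mul_nonneg hε.le (hD0 v))
        simp only [listLength, zero_add] at h3
        calc τ x₀ t₀ ≤ τ x₀ u + (τ u v + τ v t₀) := (htri _ u _).trans (by gcongr; exact htri _ _ _)
          _ ≤ ENNReal.ofReal (h * ((4 * Λ + 1) * D x₀)) +
              (ENNReal.ofReal (4 * Λ * D x₀ + (Λ + 1) * ω u v) +
                ENNReal.ofReal (distortion h ε * L)) := by gcongr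
          _ = ENNReal.ofReal (h * ((4 * Λ + 1) * D x₀) + (4 * Λ * D x₀ + (Λ + 1) * ω u v +
                distortion h ε * L)) := by
            have := hD0 x₀
            rw [← ENNReal.ofReal_add (by positivity) (by positivity),
              ← ENNReal.ofReal_add (by positivity) (by positivity)]
          _ ≤ _ := by
            refine ENNReal.ofReal_le_ofReal ?_
            -- The cost, proportional to `D x₀`, is charged to the closed piece including its last
            -- edge.
            have h7 : D x₀ ≤ (listLength ω l + ω u v) / ε := by
              rw [le_div_iff₀ hε]; linarith
            have h8 : (h * (4 * Λ + 1) + 4 * Λ) * D x₀ ≤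
                (h * (4 * Λ + 1) + 4 * Λ) * ((listLength ω l + ω u v) / ε) := by gcongr
            have h9 : (Λ + 1) * ω u v ≤ (Λ + 1) * (listLength ω l + ω u v) := by
              gcongr; linarith
            rw [hα]
            calc _ = (h * (4 * Λ + 1) + 4 * Λ) * D x₀ + (Λ + 1) * ω u v +
                  ((h * (4 * Λ + 1) + 4 * Λ) / ε + Λ + 1) * L := by ring
              _ ≤ (h * (4 * Λ + 1) + 4 * Λ) * ((listLength ω l + ω u v) / ε) +
                  (Λ + 1) * (listLength ω l + ω u v) +
                  ((h * (4 * Λ + 1) + 4 * Λ) / ε + Λ + 1) * L := by gcongr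
              _ = _ := by ring
  unfold wdist
  rw [ENNReal.mul_iInf_of_ne (by simpa using hα0) ENNReal.ofReal_ne_top]
  refine le_iInf fun p => ?_
  have := main _ _ _ (walkIn_of_walk (w := w) p) rfl s₀ [(s₀ : V)] (List.isChain_singleton _) rfl rfl
    (fun _ => rfl) (by simp only [listLength]; exact mul_nonneg hε.le (hD0 _))
  simp only [listLength, zero_add, τ, hT] at this
  rwa [ENNReal.ofReal_mul hα0.le, ENNReal.ofReal_coe_nnreal] at this

/-- Solutions exist for positive weights, uniformly in the weights. -/
theorem exists_minor_of_pos {V : Type*} [Finite V] {G : SimpleGraph V} {r : ℕ}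
    (hG : CliqueMinorFree r G) (w : Sym2 V → ℝ≥0) (hw : ∀ e, 0 < w e) (K : Set V) :
    ∃ M : SimpleGraph K, (∃ B : MinorModel M G, ∀ t : K, (t : V) ∈ B.branch t) ∧
      ∀ s t : K, wdist M (distWeight G w K) s t ≤
        ENNReal.ofReal (distortion ((6 * r + 6) ^ r : ℕ) (1 / (8 * (3 * ((r + 1) * r) + 1)))) *
          wdist G w s t := by
  rcases isEmpty_or_nonempty V with hV | hV
  · exact ⟨⊥, ⟨⟨fun t => isEmptyElim (t : V), fun t => isEmptyElim (t : V),
      fun t => isEmptyElim (t : V), fun t => isEmptyElim (t : V)⟩, fun t => isEmptyElim (t : V)⟩,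
      fun t => isEmptyElim (t : V)⟩
  have hω : ∀ u v, G.Adj u v → 0 < ((w s(u, v) : ℝ≥0) : ℝ) := fun u v _ => hw _
  have hsymm : ∀ u v, ((w s(u, v) : ℝ≥0) : ℝ) = w s(v, u) := fun u v => by rw [Sym2.eq_swap]
  obtain ⟨D, hD⟩ := exists_isTerminalDist (w := fun u v => (w s(u, v) : ℝ)) hω K
  obtain ⟨c, hc⟩ := exists_isClustering (D := D) hG hω hsymm hD.eq_zero hD.pos hD.lip
  have hr : (0 : ℝ) ≤ 3 * ((r + 1) * r) := by positivity
  refine hc.exists_minor hD hw (by positivity) ?_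
  rw [div_lt_one (by positivity)]
  linarith

/-! ### Zero weights and the numerical bound. -/

theorem distortion_pos {h ε : ℝ} (hh : 0 ≤ h) (hε : 0 < ε) : 0 < distortion h ε := by
  unfold distortion; positivity

/-- Positive weights are needed for strict descent of the potentials, so the weights are perturbed.
There are finitely many graphs on `K`, so one minor serves infinitely many perturbations and passes
to the limit. -/
theorem exists_isSolution {V : Type*} [Finite V] {G : SimpleGraph V} {r : ℕ}
    (hG : CliqueMinorFree r G) (w : Sym2 V → ℝ≥0) (K : Set V) {α : ℝ}
    (hα : distortion ((6 * r + 6) ^ r : ℕ) (1 / (8 * (3 * ((r + 1) * r) + 1))) ≤ α) :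
    ∃ (M : SimpleGraph K) (wM : Sym2 K → ℝ≥0), IsSolution G w K α M wM := by
  have hα0 : 0 < α := (distortion_pos (Nat.cast_nonneg _) (by positivity)).trans_le hα
  let w' : ℕ → Sym2 V → ℝ≥0 := fun n e => w e + 1 / ((n : ℝ≥0) + 1)
  have hw' : ∀ n e, 0 < w' n e := fun n e => by positivity
  choose M hMB hM using fun n => exists_minor_of_pos hG (w' n) (hw' n) K
  obtain ⟨M₀, hM₀⟩ := Finite.exists_infinite_fiber M
  rw [Set.infinite_coe_iff] at hM₀
  obtain ⟨n₀, hn₀⟩ := hM₀.nonempty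
  obtain ⟨B, hB⟩ : ∃ B : MinorModel M₀ G, ∀ t : K, (t : V) ∈ B.branch t := by
    have : M n₀ = M₀ := hn₀
    rw [← this]; exact hMB n₀
  have hweight : ∀ s t : K, M₀.Adj s t → (distWeight G w K s(s, t) : ℝ≥0∞) = wdist G w s t :=
    fun s t h => B.coe_distWeight hB w h
  refine ⟨M₀, distWeight G w K, ⟨B, hB⟩, hweight, wdist_le_wdist_of_weight hweight, fun s t => ?_⟩
  have hn : ∀ N, ∃ n ≥ N, wdist M₀ (distWeight G w K) s t ≤
      ENNReal.ofReal α * wdist G (w' n) s t := fun N => by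
    obtain ⟨n, hnM, hn⟩ := hM₀.exists_gt N
    have hnM : M n = M₀ := hnM
    refine ⟨n, hn.le, ?_⟩
    have h1 := hM n s t
    rw [hnM] at h1
    -- The original edge weights of the minor are at most the perturbed ones, so the perturbed upper
    -- bound applies to them as well.
    refine (wdist_mono (fun e => ?_) s t).trans (h1.trans (by gcongr))
    induction e using Sym2.ind with
    | _ a b =>
      intro hab
      have hab : M₀.Adj a b := hab
      have h2 : wdist G w a b ≤ wdist G (w' n) a b :=
        wdist_mono (fun e _ => le_self_add) _ _
      rw [← B.coe_distWeight hB w hab, ← B.coe_distWeight hB (w' n) hab] at h2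
      exact_mod_cast h2
  unfold wdist
  rw [ENNReal.mul_iInf_of_ne (by simpa using hα0) ENNReal.ofReal_ne_top]
  refine le_iInf fun p => ?_
  change wdist M₀ (distWeight G w K) s t ≤ _
  have hlen : ∀ n, walkLength (w' n) p = walkLength w p + p.edges.length * (1 / ((n : ℝ≥0) + 1)) :=
    fun n => by simp [walkLength, w', List.sum_map_add]
  have hlim : Filter.Tendsto (fun n : ℕ => ENNReal.ofReal
      (α * (walkLength w p + p.edges.length * (1 / ((n : ℝ) + 1))))) Filter.atTop
      (nhds (ENNReal.ofReal (α * (walkLength w p + p.edges.length * 0)))) := by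
    refine ENNReal.tendsto_ofReal (Filter.Tendsto.const_mul _ (Filter.Tendsto.const_add _
      (Filter.Tendsto.const_mul _ tendsto_one_div_add_atTop_nhds_zero_nat)))
  rw [mul_zero, add_zero, ENNReal.ofReal_mul hα0.le, ENNReal.ofReal_coe_nnreal] at hlim
  refine ge_of_tendsto' hlim fun N => ?_
  obtain ⟨n, hnN, h⟩ := hn N
  refine h.trans ((mul_le_mul_right (wdist_le_walkLength p) _).trans ?_)
  rw [hlen, ← ENNReal.ofReal_coe_nnreal, ← ENNReal.ofReal_mul hα0.le]
  refine ENNReal.ofReal_le_ofReal ?_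
  push_cast
  have : (N : ℝ) ≤ n := by exact_mod_cast hnN
  gcongr

/-- With `ρ = O(r²)` and `h ≤ r ^ (5 * r)`, the distortion is at most `2 ^ 15 * (ρ * h) ^ 2`.
Constants become powers of `r` because `2 ≤ r`. -/
theorem distortion_le {r : ℕ} (hr : 2 ≤ r) :
    distortion ((6 * r + 6) ^ r : ℕ) (1 / (8 * (3 * ((r + 1) * r) + 1))) ≤ (r : ℝ) ^ (25 * r) := by
  have hr' : (2 : ℝ) ≤ r := by exact_mod_cast hr
  have hr1 : (1 : ℝ) ≤ r := by linarith
  set ρ : ℝ := 3 * ((r + 1) * r) + 1 with hρ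
  have hρ1 : 1 ≤ ρ := by nlinarith
  have hρ6 : ρ ≤ 6 * (r : ℝ) ^ 2 := by nlinarith
  set h : ℝ := (((6 * r + 6) ^ r : ℕ) : ℝ) with hh
  have hh1 : 1 ≤ h := by
    rw [hh]; exact_mod_cast Nat.one_le_pow _ _ (by omega)
  have hhr : h ≤ (r : ℝ) ^ (5 * r) := by
    rw [hh, pow_mul]
    push_cast
    gcongr
    have : 6 * (r : ℝ) + 6 ≤ 2 ^ 4 * r := by linarith
    calc 6 * (r : ℝ) + 6 ≤ 2 ^ 4 * r := this
      _ ≤ r ^ 4 * r := by gcongr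
      _ = r ^ 5 := by ring
  have hρh : 1 ≤ ρ * h := one_le_mul_of_one_le_of_one_le hρ1 hh1
  have e1 : 1 + 16 * (h + 1) / (1 / (8 * ρ)) ≤ 257 * (ρ * h) := by
    rw [div_div_eq_mul_div, div_one]
    nlinarith
  have e2 : distortion h (1 / (8 * ρ)) ≤ 2 ^ 15 * (ρ * h) ^ 2 := by
    unfold distortion
    rw [div_div_eq_mul_div (_ + _), div_one]
    generalize 1 + 16 * (h + 1) / (1 / (8 * ρ)) = Λ at e1
    calc (h * (4 * Λ + 1) + 4 * Λ) * (8 * ρ) + Λ + 1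
        ≤ (h * (4 * (257 * (ρ * h)) + 1) + 4 * (257 * (ρ * h))) * (8 * ρ) + 257 * (ρ * h) + 1 := by
          gcongr
      _ = 8224 * (ρ * h) ^ 2 + 8 * (ρ * h) + 8224 * (ρ * (ρ * h)) + 257 * (ρ * h) + 1 := by ring
      _ ≤ 8224 * (ρ * h) ^ 2 + 8 * (ρ * h) ^ 2 + 8224 * (ρ * h) ^ 2 + 257 * (ρ * h) ^ 2 +
          (ρ * h) ^ 2 := by
          have f1 : ρ * h ≤ (ρ * h) ^ 2 := by nlinarith
          have f2 : ρ * (ρ * h) ≤ (ρ * h) ^ 2 := by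
            rw [sq]
            have : ρ ≤ ρ * h := by nlinarith
            gcongr
          linarith
      _ ≤ _ := by nlinarith
  refine e2.trans ?_
  calc 2 ^ 15 * (ρ * h) ^ 2 ≤ 2 ^ 15 * ((2 ^ 3 * (r : ℝ) ^ 2) * (r : ℝ) ^ (5 * r)) ^ 2 := by
        gcongr
        nlinarith
    _ ≤ (r : ℝ) ^ 15 * ((r ^ 3 * (r : ℝ) ^ 2) * (r : ℝ) ^ (5 * r)) ^ 2 := by gcongr
    _ = (r : ℝ) ^ (25 + 10 * r) := by ring
    _ ≤ (r : ℝ) ^ (25 * r) := pow_le_pow_right₀ hr1 (by omega)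

theorem exists_isSolution_of_isEmpty {V : Type*} [IsEmpty V] (G : SimpleGraph V)
    (w : Sym2 V → ℝ≥0) (K : Set V) (α : ℝ) :
    ∃ (M : SimpleGraph K) (wM : Sym2 K → ℝ≥0), IsSolution G w K α M wM :=
  ⟨⊥, fun _ => 0, ⟨⟨fun t => isEmptyElim (t : V), fun t => isEmptyElim (t : V),
      fun t => isEmptyElim (t : V), fun t => isEmptyElim (t : V)⟩, fun t => isEmptyElim (t : V)⟩,
    fun t => isEmptyElim (t : V), fun t => isEmptyElim (t : V), fun t => isEmptyElim (t : V)⟩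

/-- A single vertex already contains the complete graphs on zero and one vertices as minors. -/
theorem CliqueMinorFree.two_le {V : Type*} [Nonempty V] {G : SimpleGraph V} {r : ℕ}
    (hG : CliqueMinorFree r G) : 2 ≤ r := by
  by_contra! hr
  obtain ⟨v⟩ := ‹Nonempty V›
  have hsub : ∀ i j : Fin r, i = j := fun i j => Fin.ext (by omega)
  refine hG ⟨⟨fun _ => {v}, fun _ => ?_, fun i j hij => absurd (hsub i j) hij,
    fun i j hij => absurd (hsub i j) hij.ne⟩⟩
  exact induce_connected (ω := fun _ _ => 0) v ⟨v, rfl⟩ fun u hu =>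
    ⟨0, by rw [show u = v from hu]; exact WalkIn.nil rfl⟩

end SPR

theorem theorem2 :
    ∃ C : ℝ, 0 < C ∧
      ∀ (r : ℕ) (V : Type*) [Finite V] (G : SimpleGraph V) (w : Sym2 V → ℝ≥0) (K : Set V),
        SPR.CliqueMinorFree r G →
          ∃ (M : SimpleGraph K) (wM : Sym2 K → ℝ≥0),
            SPR.IsSolution G w K ((2 : ℝ) ^ (C * ((r : ℝ) * Real.log (r : ℝ)))) M wM := by
  have hlog : 0 < Real.log 2 := Real.log_pos (by norm_num)
  -- The division by `Real.log 2` converts `r ^ (25 * r)`, an exponential of `25 * r * log r`, to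
  -- base two.
  refine ⟨25 / Real.log 2, by positivity, fun r V _ G w K hG => ?_⟩
  rcases isEmpty_or_nonempty V with hV | hV
  · exact SPR.exists_isSolution_of_isEmpty G w K _
  · have hr := hG.two_le
    have hr0 : (0 : ℝ) < r := by positivity
    refine SPR.exists_isSolution hG w K ((SPR.distortion_le hr).trans_eq ?_)
    rw [← Real.rpow_natCast, Real.rpow_def_of_pos hr0, Real.rpow_def_of_pos two_pos]
    congr 1
    push_cast
    field_simp
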